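/- For nonzero integers $m,n$ let $\mathrm{BS}(m,n)=\langle a,b \mid ab^ma^{-1}=b^n\rangle$ be the Baumslag-Solitar group. An action of a group $G$ on an infinite countable set $X$ is \emph{highly transitive} if for every $k\ge 1$ and any two $k$-tuples $(x_1,\dots,x_k)$, $(y_1,\dots,y_k)$ of elements of $X$, each with pairwise distinct entries, some element of $G$ takes $x_i$ to $y_i$ for all $i$; it is \emph{highly faithful} if for every finite $F\subseteq G\setminus\{1\}$ the intersection of the supports of the elements of $F$ is infinite (the support of $g$ is the set of points that $g$ moves). A group is \emph{highly transitive} if it admits a faithful highly transitive action on an infinite countable set, and \emph{icc} if all its non-trivial conjugacy classes are infinite. The \emph{transitivity degree} $\mathrm{td}(G)\in\mathbb{N}\cup\{+\infty\}$ of an infinite group $G$ is the supremum of the $k\in\mathbb{N}$ such that $G$ has a faithful action for which any $k$-tuple of distinct points can be taken to any other one by an element of $G$. \textbf{Corollary D.} Let $m,n\in\mathbb{Z}\setminus\{0\}$. The following are equivalent: (i) $|m|\neq 1$, $|n|\neq 1$ and $|m|\neq|n|$; (ii) $\mathrm{BS}(m,n)$ admits an action on an infinite countable set which is both highly transitive and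 highly faithful; (iii) $\mathrm{BS}(m,n)$ is highly transitive; (iv) $\mathrm{BS}(m,n)$ is non-solvable and icc. Moreover, if $|m|=1$ or $|n|=1$ or $|m|=|n|$, then $\mathrm{td}(\mathrm{BS}(m,n))=1$; in all other cases $\mathrm{td}(\mathrm{BS}(m,n))=+\infty$. In particular, $\mathrm{BS}(2,3)$ is highly transitive. -/

import Mathlib

universe u

/-- The Baumslag-Solitar group `BS(m,n) = ⟨a, b | a b^m a⁻¹ = b^n⟩`, where `a` and `b` are the
generators indexed by `0` and `1`. -/
abbrev BaumslagSolitar (m n : ℤ) : Type :=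
  PresentedGroup
    ({FreeGroup.of 0 * FreeGroup.of 1 ^ m * (FreeGroup.of 0)⁻¹ * (FreeGroup.of 1 ^ n)⁻¹} :
      Set (FreeGroup (Fin 2)))

/-- An action is highly transitive if, for every `k`, any `k`-tuple of pairwise distinct points
can be taken to any other one by a group element. -/
def IsHighlyTransitiveAction (G X : Type*) [Group G] [MulAction G X] : Prop :=
  ∀ k : ℕ, ∀ x y : Fin k ↪ X, ∃ g : G, ∀ i, g • x i = y i

/-- An action is highly faithful if the intersection of the supports of the elements of any
finite set of non-trivial group elements is infinite. -/
def IsHighlyFaithfulAction (G X : Type*) [Group G] [MulAction G X] : Prop :=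
  ∀ F : Finset G, 1 ∉ F → {x : X | ∀ g ∈ F, g • x ≠ x}.Infinite

/-- A group is highly transitive if it admits a faithful and highly transitive action on an
infinite countable set. -/
def IsHighlyTransitiveGroup (G : Type u) [Group G] : Prop :=
  ∃ (X : Type u) (_ : Infinite X) (_ : Countable X) (_ : MulAction G X),
    FaithfulSMul G X ∧ IsHighlyTransitiveAction G X

/-- The group admits an action on an infinite countable set which is both highly transitive and
highly faithful. -/
def AdmitsHighlyTransitiveHighlyFaithfulAction (G : Type u) [Group G] : Prop :=
  ∃ (X : Type u) (_ : Infinite X) (_ : Countable X) (_ : MulAction G X),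
    IsHighlyTransitiveAction G X ∧ IsHighlyFaithfulAction G X

/-- A group is icc if all its non-trivial conjugacy classes are infinite. -/
def IsICC (G : Type*) [Group G] : Prop :=
  ∀ g : G, g ≠ 1 → (conjugatesOf g).Infinite

/-- The transitivity degree of an action: the supremum of all `k` such that any `k`-tuple of
pairwise distinct points can be taken to any other one by a group element. It is meant for
actions on infinite sets. -/
noncomputable def actionTransitivityDegree (G X : Type*) [Group G] [MulAction G X] : ℕ∞ :=
  ⨆ (k : ℕ) (_ : ∀ x y : Fin k ↪ X, ∃ g : G, ∀ i, g • x i = y i), (k : ℕ∞)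

/-- The transitivity degree of an infinite group: the supremum of the transitivity degrees of its
faithful actions (a faithful action of an infinite group is on an infinite set, and a transitive
one is on a quotient of the group, so the universe of the group is large enough). -/
noncomputable def transitivityDegree (G : Type u) [Group G] : ℕ∞ :=
  ⨆ (X : Type u) (_ : MulAction G X) (_ : FaithfulSMul G X), actionTransitivityDegree G X

/-! Let `b` translate every line of `ℕ × ℤ` by one step. Extending this to an action of the group
amounts to choosing a permutation `τ` for `a` that carries translation by `m` to translation by `n`.
Under pointwise convergence of `τ` and `τ⁻¹` such permutations satisfy the Baire property, and each
instance of high transitivity or high faithfulness is an open condition on `τ`. It therefore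
suffices that each instance is dense (`EquivariantPerm.exists_generic`).

For faithfulness (`exists_agreeOn_free`), a copy of the left regular action is glued onto unused
lines. For transitivity (`exists_agreeOn_transport`), inverting `a` reduces to `2 ≤ |n| < |m|`. A
finite part of `τ` is extended to an injective, equivariant map `f` that sends each remaining
`m`-orbit to a line of its own. A finite union of lines has more `m`-orbits than `n`-orbits, so
points can escape the old lines; and when two escaped points have images on one line, `f` shrinks
their distance by `|n| / |m| < 1`, so they eventually separate. As `|n| ≥ 2`, one further step of
`b` leaves the image of `f`, where `a⁻¹` is still free to be chosen: the end points coming from `x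
i` and `y i` get adjacent preimages on a new line, and `b` links these.

Conversely, 2-transitivity forces infinite conjugacy classes, and 4-transitivity on an infinite set
excludes solvability. For the excluded parameters there is an abelian normal subgroup containing a
nontrivial power of `b`. A faithful 2-transitive action would make all its nontrivial elements
conjugate, whereas the affine action on `ℚ` shows that exponents of conjugate powers of `b` differ
by a factor `(n / m) ^ i`, and these factors miss some integer greater than 1. -/

/-- The point of `ℕ × ℤ` obtained by moving `x` by `k` steps along its line. -/
def shift (k : ℤ) (x : ℕ × ℤ) : ℕ × ℤ := (x.1, x.2 + k)

@[simp] theorem shift_fst (k : ℤ) (x : ℕ × ℤ) : (shift k x).1 = x.1 := rfl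

@[simp] theorem shift_snd (k : ℤ) (x : ℕ × ℤ) : (shift k x).2 = x.2 + k := rfl

@[simp] theorem shift_zero (x : ℕ × ℤ) : shift 0 x = x := by simp [shift]

@[simp] theorem shift_shift (k l : ℤ) (x : ℕ × ℤ) : shift k (shift l x) = shift (l + k) x := by
  simp [shift, add_assoc]

theorem shift_eq_iff {k : ℤ} {x y : ℕ × ℤ} : shift k x = y ↔ x = shift (-k) y := by
  constructor <;> rintro rfl <;> simp

theorem shift_left_injective (x : ℕ × ℤ) : Function.Injective fun k => shift k x := by
  intro k l h
  simpa [shift] using h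

theorem shift_injective (k : ℤ) : Function.Injective (shift k) := by
  intro x y h
  rw [shift_eq_iff] at h
  simpa using h

theorem exists_eq_shift {x y : ℕ × ℤ} (h : y.1 = x.1) : ∃ k, y = shift k x :=
  ⟨y.2 - x.2, by ext <;> simp [h]⟩

/-- The shift by one step, as a permutation. -/
def shiftPerm : Equiv.Perm (ℕ × ℤ) where
  toFun := shift 1
  invFun := shift (-1)
  left_inv x := by simp
  right_inv x := by simp

theorem shiftPerm_zpow_apply (k : ℤ) (x : ℕ × ℤ) : (shiftPerm ^ k) x = shift k x := by
  have h1 : ∀ y, shiftPerm y = shift 1 y := fun _ => rfl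
  have h2 : ∀ y, shiftPerm⁻¹ y = shift (-1) y := fun _ => rfl
  induction k generalizing x with
  | zero => simp
  | succ k ih => rw [zpow_add_one, Equiv.Perm.mul_apply, ih, h1, shift_shift, add_comm]
  | pred k ih => rw [zpow_sub_one, Equiv.Perm.mul_apply, ih, h2, shift_shift, add_comm, sub_eq_add_neg]

/-! ### Extending partial equivariant injections -/

/-- A set with a permutation all of whose cycles are infinite is a union of copies of `ℤ`. -/
theorem exists_equiv_of_free {A : Type*} (α : Equiv.Perm A)
    (h : ∀ x (k : ℤ), (α ^ k) x = x → k = 0) :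
    ∃ e : A ≃ Quotient (Equiv.Perm.SameCycle.setoid α) × ℤ,
      ∀ x (k : ℤ), e ((α ^ k) x) = ((e x).1, (e x).2 + k) := by
  let f : Quotient (Equiv.Perm.SameCycle.setoid α) × ℤ → A := fun p => (α ^ p.2) p.1.out
  have hq : ∀ q (k : ℤ), (Quotient.mk _ ((α ^ k) (Quotient.out q)) :
      Quotient (Equiv.Perm.SameCycle.setoid α)) = q := by
    intro q k
    conv_rhs => rw [← Quotient.out_eq q]
    exact Quotient.sound ⟨-k, by simp⟩
  have hf : Function.Bijective f := by
    constructor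
    · rintro ⟨q, k⟩ ⟨q', k'⟩ he
      simp only [f] at he
      have hqq : q = q' := by rw [← hq q k, he, hq]
      subst hqq
      have := h q.out (-k' + k) (by rw [zpow_add, Equiv.Perm.mul_apply, he]; simp)
      simp only [Prod.mk.injEq, true_and]
      lia
    · intro x
      obtain ⟨k, hk⟩ : Equiv.Perm.SameCycle α
          (Quotient.out (Quotient.mk (Equiv.Perm.SameCycle.setoid α) x)) x :=
        Quotient.exact (Quotient.out_eq (Quotient.mk (Equiv.Perm.SameCycle.setoid α) x))
      exact ⟨(_, k), hk⟩
  refine ⟨(Equiv.ofBijective f hf).symm, fun x l => ?_⟩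
  rw [Equiv.symm_apply_eq]
  obtain ⟨⟨q, k⟩, rfl⟩ := (Equiv.ofBijective f hf).surjective x
  simp only [Equiv.symm_apply_apply]
  simp [f, add_comm k l, zpow_add]

/-- The cycles of translation by `m ≠ 0` are infinite, and distinct lines contained in `E`
contribute distinct cycles. The set of cycles is thus countably infinite and can be identified with
`ℕ`. -/
theorem exists_equiv_of_shift_invariant {m : ℤ} (hm : m ≠ 0) (E : Set (ℕ × ℤ))
    (hE : ∀ x, shift m x ∈ E ↔ x ∈ E) (hinf : {i : ℕ | ∀ j, (i, j) ∈ E}.Infinite) :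
    ∃ e : E ≃ ℕ × ℤ, ∀ (x : E) h, e ⟨shift m x, h⟩ = shift 1 (e x) := by
  let α : Equiv.Perm E := (shiftPerm ^ m).subtypePerm
    (fun x => by rw [shiftPerm_zpow_apply]; exact hE x)
  have hα : ∀ (x : E) (k : ℤ), ((α ^ k) x : ℕ × ℤ) = shift (m * k) x := by
    intro x k
    simp only [α, Equiv.Perm.subtypePerm_zpow, Equiv.Perm.subtypePerm_apply, ← zpow_mul,
      shiftPerm_zpow_apply]
  obtain ⟨e, he⟩ := exists_equiv_of_free α (fun x k h => by
    have h2 := congrArg Subtype.val h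
    rw [hα] at h2
    have := shift_left_injective _ (h2.trans (shift_zero _).symm)
    simpa [hm] using this)
  have : Infinite {i : ℕ | ∀ j, (i, j) ∈ E} := hinf.to_subtype
  have : Infinite (Quotient (Equiv.Perm.SameCycle.setoid α)) := by
    refine Infinite.of_injective
      (fun i : {i : ℕ | ∀ j, (i, j) ∈ E} => Quotient.mk _ ⟨(i.1, 0), i.2 0⟩) ?_
    intro i i' h
    obtain ⟨k, hk⟩ := Quotient.exact h
    have := congrArg (fun x : E => (x : ℕ × ℤ).1) hk
    simp only [hα] at this
    exact Subtype.ext this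
  have : Countable (Quotient (Equiv.Perm.SameCycle.setoid α)) := Quotient.countable
  obtain ⟨d⟩ : Nonempty (Quotient (Equiv.Perm.SameCycle.setoid α) ≃ ℕ) := nonempty_equiv_of_countable
  refine ⟨e.trans (d.prodCongr (Equiv.refl ℤ)), fun x h => ?_⟩
  have hx : (⟨shift m x, h⟩ : E) = α x := Subtype.ext (by simpa using (hα x 1).symm)
  have h1 := he x 1
  rw [zpow_one] at h1
  rw [hx]
  simp [h1, shift]

/-- A partial injection of `ℕ × ℤ` which intertwines the shifts by `m` and by `n` and which misses
infinitely many lines on both sides extends to a permutation with the same property. -/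
theorem exists_equivariant_perm_of_injOn {m n : ℤ} (hm : m ≠ 0) (hn : n ≠ 0) (D : Set (ℕ × ℤ))
    (f : ℕ × ℤ → ℕ × ℤ) (hinj : Set.InjOn f D) (hD : ∀ x, shift m x ∈ D ↔ x ∈ D)
    (hf : ∀ x ∈ D, f (shift m x) = shift n (f x))
    (hdom : {i : ℕ | ∀ j, (i, j) ∉ D}.Infinite) (hran : {i : ℕ | ∀ j, (i, j) ∉ f '' D}.Infinite) :
    ∃ τ : Equiv.Perm (ℕ × ℤ), (∀ x, τ (shift m x) = shift n (τ x)) ∧ ∀ x ∈ D, τ x = f x := by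
  classical
  have hR : ∀ y, shift n y ∈ (f '' D)ᶜ ↔ y ∈ (f '' D)ᶜ := by
    intro y
    rw [Set.mem_compl_iff, Set.mem_compl_iff, not_iff_not]
    constructor
    · rintro ⟨x, hx, hxy⟩
      have hx' : shift (-m) x ∈ D := (hD _).1 (by simpa using hx)
      refine ⟨_, hx', shift_injective n ?_⟩
      rw [← hf _ hx']
      simpa using hxy
    · rintro ⟨x, hx, rfl⟩
      exact ⟨_, (hD x).2 hx, hf x hx⟩
  obtain ⟨d, hd⟩ := exists_equiv_of_shift_invariant hm Dᶜ (fun x => not_congr (hD x)) hdom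
  obtain ⟨r, hr⟩ := exists_equiv_of_shift_invariant hn (f '' D)ᶜ hR hran
  let g : ℕ × ℤ → ℕ × ℤ := fun x => if h : x ∈ D then f x else r.symm (d ⟨x, h⟩)
  have g1 : ∀ x ∈ D, g x = f x := fun x h => dif_pos h
  have g2 : ∀ x (h : x ∉ D), g x = r.symm (d ⟨x, h⟩) := fun x h => dif_neg h
  have g3 : ∀ x, x ∉ D → g x ∉ f '' D := fun x h => by
    rw [g2 x h]; exact (r.symm (d ⟨x, h⟩)).2
  have hg : Function.Bijective g := by
    constructor
    · intro x y hxy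
      by_cases hx : x ∈ D <;> by_cases hy : y ∈ D
      · rw [g1 x hx, g1 y hy] at hxy
        exact hinj hx hy hxy
      · exact absurd ⟨x, hx, (g1 x hx).symm.trans hxy⟩ (g3 y hy)
      · exact absurd ⟨y, hy, (g1 y hy).symm.trans hxy.symm⟩ (g3 x hx)
      · rw [g2 x hx, g2 y hy] at hxy
        simpa using d.injective (r.symm.injective (Subtype.ext hxy))
    · intro y
      by_cases hy : y ∈ f '' D
      · obtain ⟨x, hx, rfl⟩ := hy
        exact ⟨x, g1 x hx⟩
      · refine ⟨d.symm (r ⟨y, hy⟩), ?_⟩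
        rw [g2 _ (d.symm (r ⟨y, hy⟩)).2]
        simp
  refine ⟨Equiv.ofBijective g hg, fun x => ?_, fun x hx => g1 x hx⟩
  simp only [Equiv.ofBijective_apply]
  by_cases hx : x ∈ D
  · rw [g1 x hx, g1 _ ((hD x).2 hx), hf x hx]
  · have hx' : shift m x ∉ D := fun h => hx ((hD x).1 h)
    rw [g2 x hx, g2 _ hx', hd ⟨x, hx⟩ hx']
    have hz := (hR _).2 (r.symm (d ⟨x, hx⟩)).2
    have := hr (r.symm (d ⟨x, hx⟩)) hz
    rw [Equiv.apply_symm_apply] at this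
    rw [← this, Equiv.symm_apply_apply]

/-- A set of prescribed values `(x, y)` for a permutation intertwining the shifts by `m` and by `n`
can be realised if it is consistent and leaves infinitely many lines free on both sides. -/
theorem exists_equivariant_perm {m n : ℤ} (hm : m ≠ 0) (hn : n ≠ 0)
    {ι : Type*} (s t : ι → ℕ × ℤ)
    (hst : ∀ p q k, s q = shift (m * k) (s p) ↔ t q = shift (n * k) (t p))
    (hdom : {i : ℕ | ∀ p, (s p).1 ≠ i}.Infinite) (hran : {i : ℕ | ∀ p, (t p).1 ≠ i}.Infinite) :
    ∃ τ : Equiv.Perm (ℕ × ℤ), (∀ x, τ (shift m x) = shift n (τ x)) ∧ ∀ p, τ (s p) = t p := by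
  classical
  let D : Set (ℕ × ℤ) := {x | ∃ p k, x = shift (m * k) (s p)}
  -- By `hst`, the value forced at `x` is the same whichever prescription reaches `x`.
  have hex : ∀ x, ∃ y, ∀ p k, x = shift (m * k) (s p) → y = shift (n * k) (t p) := by
    intro x
    by_cases hx : x ∈ D
    · obtain ⟨p, k, rfl⟩ := hx
      refine ⟨shift (n * k) (t p), fun q l h => ?_⟩
      have := (hst p q (k - l)).1 (by
        rw [eq_comm, shift_eq_iff] at h
        rw [h]; simp; ring_nf)
      rw [this]; simp; ring_nf
    · exact ⟨x, fun p k h => absurd ⟨p, k, h⟩ hx⟩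
  choose f hf using hex
  have hfs : ∀ p k, f (shift (m * k) (s p)) = shift (n * k) (t p) := fun p k => hf _ p k rfl
  have hinj : Set.InjOn f D := by
    rintro _ ⟨p, k, rfl⟩ _ ⟨q, l, rfl⟩ h
    rw [hfs, hfs, eq_comm, shift_eq_iff, shift_shift] at h
    have := (hst p q (k - l)).2 (by rw [h]; ring_nf)
    rw [this, shift_shift]
    ring_nf
  have hD : ∀ x, shift m x ∈ D ↔ x ∈ D := by
    intro x
    constructor
    · rintro ⟨p, k, h⟩
      exact ⟨p, k - 1, by rw [shift_eq_iff, shift_shift] at h; rw [h]; ring_nf⟩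
    · rintro ⟨p, k, rfl⟩
      exact ⟨p, k + 1, by rw [shift_shift]; ring_nf⟩
  have hfD : ∀ x ∈ D, f (shift m x) = shift n (f x) := by
    rintro _ ⟨p, k, rfl⟩
    rw [hfs, shift_shift, shift_shift, ← mul_add_one, hfs, mul_add_one]
  have hdom' : {i : ℕ | ∀ j, (i, j) ∉ D}.Infinite := by
    refine hdom.mono ?_
    rintro i hi j ⟨p, k, h⟩
    exact hi p (congrArg Prod.fst h).symm
  have hran' : {i : ℕ | ∀ j, (i, j) ∉ f '' D}.Infinite := by
    refine hran.mono ?_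
    rintro i hi j ⟨_, ⟨p, k, rfl⟩, h⟩
    rw [hfs] at h
    exact hi p (congrArg Prod.fst h)
  obtain ⟨τ, h1, h2⟩ := exists_equivariant_perm_of_injOn hm hn D f hinj hD hfD hdom' hran'
  refine ⟨τ, h1, fun p => ?_⟩
  have := h2 (s p) ⟨p, 0, by simp⟩
  rw [this]
  simpa using hfs p 0

/-! ### The Baire argument for equivariant permutations -/

/-- The permutations of `ℕ × ℤ` which intertwine the shifts by `m` and by `n`. -/
def EquivariantPerm (m n : ℤ) : Type :=
  {τ : Equiv.Perm (ℕ × ℤ) // ∀ x, τ (shift m x) = shift n (τ x)}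

/-- Two equivariant permutations agree on `S`, and so do their inverses. -/
def EquivariantPerm.AgreeOn {m n : ℤ} (S : Finset (ℕ × ℤ)) (τ τ' : EquivariantPerm m n) : Prop :=
  ∀ x ∈ S, τ'.1 x = τ.1 x ∧ τ'.1⁻¹ x = τ.1⁻¹ x

theorem EquivariantPerm.AgreeOn.mono {m n : ℤ} {S S' : Finset (ℕ × ℤ)} {τ τ' : EquivariantPerm m n}
    (h : EquivariantPerm.AgreeOn S' τ τ') (hS : S ⊆ S') : EquivariantPerm.AgreeOn S τ τ' :=
  fun x hx => h x (hS hx)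

theorem EquivariantPerm.AgreeOn.trans {m n : ℤ} {S : Finset (ℕ × ℤ)}
    {τ τ' τ'' : EquivariantPerm m n} (h : EquivariantPerm.AgreeOn S τ τ')
    (h' : EquivariantPerm.AgreeOn S τ' τ'') : EquivariantPerm.AgreeOn S τ τ'' :=
  fun x hx => ⟨(h' x hx).1.trans (h x hx).1, (h' x hx).2.trans (h x hx).2⟩

theorem EquivariantPerm.zpow_shift {m n : ℤ} (τ : EquivariantPerm m n) (k : ℤ) (x : ℕ × ℤ) :
    τ.1 (shift (m * k) x) = shift (n * k) (τ.1 x) := by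
  have h : τ.1 * shiftPerm ^ m * τ.1⁻¹ = shiftPerm ^ n := by
    rw [mul_inv_eq_iff_eq_mul]
    ext1 y
    rw [Equiv.Perm.mul_apply, Equiv.Perm.mul_apply, shiftPerm_zpow_apply, shiftPerm_zpow_apply, τ.2]
  have h2 : τ.1 * shiftPerm ^ (m * k) = shiftPerm ^ (n * k) * τ.1 := by
    rw [← mul_inv_eq_iff_eq_mul, zpow_mul, zpow_mul, ← h, conj_zpow]
  simpa [shiftPerm_zpow_apply] using congrArg (fun σ => σ x) h2

/-- An equivariant permutation with a finite set of points at which it is to be kept. -/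
structure PinnedPerm (m n : ℤ) where
  perm : EquivariantPerm m n
  pins : Finset (ℕ × ℤ)

instance (m n : ℤ) : Preorder (PinnedPerm m n) where
  le p q := p.pins ⊆ q.pins ∧ EquivariantPerm.AgreeOn p.pins p.perm q.perm
  le_refl p := ⟨subset_rfl, fun x _ => ⟨rfl, rfl⟩⟩
  le_trans p q r h h' := ⟨h.1.trans h'.1, h.2.trans (h'.2.mono h.1)⟩

/-- Countably many dense open sets of equivariant permutations have a common point. -/
theorem EquivariantPerm.exists_generic {m n : ℤ} {ι : Type*} [Countable ι]
    (τ₀ : EquivariantPerm m n) (O : ι → Set (EquivariantPerm m n))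
    (hopen : ∀ i, ∀ τ ∈ O i, ∃ S, ∀ τ', EquivariantPerm.AgreeOn S τ τ' → τ' ∈ O i)
    (hdense : ∀ i τ S, ∃ τ', EquivariantPerm.AgreeOn S τ τ' ∧ τ' ∈ O i) :
    ∃ τ : EquivariantPerm m n, ∀ i, τ ∈ O i := by
  classical
  have := Encodable.ofCountable ι
  -- The first family forces membership in each `O i`; the second pins every point, so that the
  -- generic ideal determines a permutation.
  let C : ι ⊕ (ℕ × ℤ) → Order.Cofinal (PinnedPerm m n)
    | .inl i =>
      { carrier := {p | ∀ τ', EquivariantPerm.AgreeOn p.pins p.perm τ' → τ' ∈ O i}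
        isCofinal := by
          intro p
          obtain ⟨τ, h1, h2⟩ := hdense i p.perm p.pins
          obtain ⟨S, hS⟩ := hopen i τ h2
          exact ⟨⟨τ, p.pins ∪ S⟩, fun τ' h => hS τ' (h.mono Finset.subset_union_right),
            Finset.subset_union_left, h1⟩ }
    | .inr x =>
      { carrier := {p | x ∈ p.pins}
        isCofinal := fun p => ⟨⟨p.perm, insert x p.pins⟩, Finset.mem_insert_self _ _,
          Finset.subset_insert _ _, fun x _ => ⟨rfl, rfl⟩⟩ }
  let I := Order.idealOfCofinals (⟨τ₀, ∅⟩ : PinnedPerm m n) C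
  have hI : ∀ x, ∃ p ∈ I, x ∈ p.pins := fun x => by
    obtain ⟨p, h1, h2⟩ := Order.cofinal_meets_idealOfCofinals (⟨τ₀, ∅⟩ : PinnedPerm m n) C (.inr x)
    exact ⟨p, h2, h1⟩
  choose p hpI hp using hI
  have hup : ∀ q ∈ I, ∀ q' ∈ I, ∃ r ∈ I, q ≤ r ∧ q' ≤ r := fun q hq q' hq' => I.directed q hq q' hq'
  have key : ∀ q ∈ I, ∀ x ∈ q.pins,
      (p x).perm.1 x = q.perm.1 x ∧ (p x).perm.1⁻¹ x = q.perm.1⁻¹ x := by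
    intro q hq x hx
    obtain ⟨r, -, h1, h2⟩ := hup _ (hpI x) q hq
    exact ⟨(h1.2 x (hp x)).1.symm.trans (h2.2 x hx).1, (h1.2 x (hp x)).2.symm.trans (h2.2 x hx).2⟩
  -- Any two points are pinned by one member of `I`, so bijectivity and equivariance of the limit
  -- are inherited from actual permutations.
  have key2 : ∀ x y, ∃ q ∈ I, x ∈ q.pins ∧ y ∈ q.pins := by
    intro x y
    obtain ⟨r, hr, h1, h2⟩ := hup _ (hpI x) _ (hpI y)
    exact ⟨r, hr, h1.1 (hp x), h2.1 (hp y)⟩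
  let τ : EquivariantPerm m n :=
    ⟨{toFun := fun x => (p x).perm.1 x
      invFun := fun x => (p x).perm.1⁻¹ x
      left_inv := by
        intro x
        obtain ⟨q, hq, h1, h2⟩ := key2 x ((p x).perm.1 x)
        simp only
        rw [(key q hq _ h2).2, (key q hq _ h1).1]
        simp
      right_inv := by
        intro x
        obtain ⟨q, hq, h1, h2⟩ := key2 x ((p x).perm.1⁻¹ x)
        simp only
        rw [(key q hq _ h2).1, (key q hq _ h1).2]
        simp }, by
      intro x
      obtain ⟨q, hq, h1, h2⟩ := key2 x (shift m x)
      simp only [Equiv.coe_fn_mk]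
      rw [(key q hq _ h2).1, (key q hq _ h1).1]
      exact q.perm.2 x⟩
  refine ⟨τ, fun i => ?_⟩
  obtain ⟨q, h1, h2⟩ := Order.cofinal_meets_idealOfCofinals (⟨τ₀, ∅⟩ : PinnedPerm m n) C (.inl i)
  exact h1 τ (fun x hx => key q h2 x hx)

/-! ### The group and its action attached to an equivariant permutation -/

namespace BaumslagSolitar

variable {m n : ℤ}

/-- The stable letter. -/
def a : BaumslagSolitar m n := PresentedGroup.of 0

/-- The generator of the base group. -/
def b : BaumslagSolitar m n := PresentedGroup.of 1

theorem relation : (a * b ^ m * a⁻¹ : BaumslagSolitar m n) = b ^ n := by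
  have := PresentedGroup.one_of_mem (rels := {FreeGroup.of 0 * FreeGroup.of 1 ^ m *
    (FreeGroup.of 0)⁻¹ * (FreeGroup.of 1 ^ n)⁻¹}) (x := FreeGroup.of (0 : Fin 2) *
    FreeGroup.of 1 ^ m * (FreeGroup.of 0)⁻¹ * (FreeGroup.of 1 ^ n)⁻¹) rfl
  simp only [map_mul, map_inv, map_zpow] at this
  exact mul_inv_eq_one.1 this

/-- The homomorphism given by a pair of elements satisfying the defining relation. -/
def lift {H : Type*} [Group H] (s t : H) (h : s * t ^ m * s⁻¹ = t ^ n) :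
    BaumslagSolitar m n →* H :=
  PresentedGroup.toGroup (f := ![s, t]) (by
    rintro r rfl
    simp [h])

variable {H : Type*} [Group H] {s t : H} (h : s * t ^ m * s⁻¹ = t ^ n)

@[simp] theorem lift_a : lift s t h a = s := PresentedGroup.toGroup.of _

@[simp] theorem lift_b : lift s t h b = t := PresentedGroup.toGroup.of _

theorem hom_ext {φ ψ : BaumslagSolitar m n →* H} (ha : φ a = ψ a) (hb : φ b = ψ b) : φ = ψ := by
  refine PresentedGroup.ext fun x => ?_
  fin_cases x
  · exact ha
  · exact hb

theorem closure_eq_top : Subgroup.closure {(a : BaumslagSolitar m n), b} = ⊤ := by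
  rw [← PresentedGroup.closure_range_of]
  congr 1
  ext x
  simp [a, b, Fin.exists_fin_two, eq_comm]

instance : Countable (BaumslagSolitar m n) :=
  (PresentedGroup.mk_surjective _).countable

/-- A predicate which holds for the generators and is compatible with products and inverses holds
everywhere. -/
theorem induction {p : BaumslagSolitar m n → Prop} (ha : p a) (hb : p b)
    (hmul : ∀ g h, p g → p h → p (g * h)) (hinv : ∀ g, p g → p g⁻¹) (g : BaumslagSolitar m n) :
    p g := by
  have hg : g ∈ Subgroup.closure {(a : BaumslagSolitar m n), b} := by simp [closure_eq_top]
  induction hg using Subgroup.closure_induction with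
  | mem x hx =>
    obtain rfl | rfl := hx
    · exact ha
    · exact hb
  | one => simpa using hmul _ _ ha (hinv _ ha)
  | mul x y _ _ hx hy => exact hmul x y hx hy
  | inv x _ hx => exact hinv x hx

/-- The action on `ℕ × ℤ` in which `b` is the shift by one step and `a` is `τ`. -/
def rep (τ : EquivariantPerm m n) : BaumslagSolitar m n →* Equiv.Perm (ℕ × ℤ) :=
  lift τ.1 shiftPerm (by
    rw [mul_inv_eq_iff_eq_mul]
    ext1 x
    rw [Equiv.Perm.mul_apply, Equiv.Perm.mul_apply, shiftPerm_zpow_apply, shiftPerm_zpow_apply,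
      τ.2])

theorem rep_a (τ : EquivariantPerm m n) (x : ℕ × ℤ) : rep τ a x = τ.1 x := by simp [rep]

theorem rep_b (τ : EquivariantPerm m n) (x : ℕ × ℤ) : rep τ b x = shift 1 x := by
  simp [rep, shiftPerm]

theorem rep_b_zpow (τ : EquivariantPerm m n) (k : ℤ) (x : ℕ × ℤ) :
    rep τ (b ^ k) x = shift k x := by
  rw [map_zpow]
  simp only [rep, lift_b, shiftPerm_zpow_apply]

/-- The action of a group element on a point depends continuously on `τ`. -/
theorem rep_continuous (τ : EquivariantPerm m n) (g : BaumslagSolitar m n) :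
    ∀ x, ∃ S, ∀ τ', EquivariantPerm.AgreeOn S τ τ' → rep τ' g x = rep τ g x := by
  classical
  induction g using induction with
  | ha => exact fun x => ⟨{x}, fun τ' h => by simpa [rep_a] using (h x (by simp)).1⟩
  | hb => exact fun x => ⟨∅, fun τ' h => by simp [rep_b]⟩
  | hmul g h hg hh =>
    intro x
    obtain ⟨S, hS⟩ := hh x
    obtain ⟨S', hS'⟩ := hg (rep τ h x)
    refine ⟨S ∪ S', fun τ' hτ => ?_⟩
    rw [map_mul, map_mul, Equiv.Perm.mul_apply, Equiv.Perm.mul_apply,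
      hS τ' (hτ.mono Finset.subset_union_left), hS' τ' (hτ.mono Finset.subset_union_right)]
  | hinv g hg =>
    intro x
    obtain ⟨S, hS⟩ := hg (rep τ g⁻¹ x)
    refine ⟨S, fun τ' hτ => ?_⟩
    rw [map_inv, Equiv.Perm.inv_eq_iff_eq, hS τ' hτ]
    simp

end BaumslagSolitar

open EquivariantPerm

/-- The inverse is controlled on `S` by forward values at the preimages of `S`, so later
constructions only prescribe forward values. -/
theorem EquivariantPerm.agreeOn_of_eqOn {m n : ℤ} {τ τ' : EquivariantPerm m n}
    {S : Finset (ℕ × ℤ)} (h : ∀ x ∈ S ∪ S.image ⇑(τ.1⁻¹), τ'.1 x = τ.1 x) : AgreeOn S τ τ' := by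
  refine fun x hx => ⟨h x (Finset.mem_union_left _ hx), ?_⟩
  rw [Equiv.Perm.inv_eq_iff_eq, h _ (Finset.mem_union_right _ (Finset.mem_image_of_mem _ hx))]
  simp

theorem Finset.exists_fst_lt (T : Finset (ℕ × ℤ)) : ∃ N : ℕ, ∀ x ∈ T, x.1 < N := by
  obtain ⟨N, hN⟩ := (T.image Prod.fst).exists_nat_subset_range
  exact ⟨N, fun x hx => Finset.mem_range.1 (hN (Finset.mem_image_of_mem _ hx))⟩

theorem infinite_setOf_fst_ne {J : Type*} [Finite J] (s : J → ℕ × ℤ) :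
    {i : ℕ | ∀ p, (s p).1 ≠ i}.Infinite := by
  have h : {i : ℕ | ∀ p, (s p).1 ≠ i} = (Set.range fun p => (s p).1)ᶜ := by
    ext i
    simp
  rw [h]
  exact (Set.finite_range _).infinite_compl

/-! ### Spreading points over separate lines -/

/-- A finite part of an equivariant permutation extends to an injective equivariant map which sends
all other orbits to separate lines, apart from a finite set of lines. -/
theorem EquivariantPerm.exists_spread {m n : ℤ} (hm : m ≠ 0) (hn : n ≠ 0)
    (τ : EquivariantPerm m n) (T : Finset (ℕ × ℤ)) :
    ∃ (N : ℕ) (f : ℕ × ℤ → ℕ × ℤ), (∀ x ∈ T, f x = τ.1 x) ∧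
      (∀ x y k, y = shift (m * k) x ↔ f y = shift (n * k) (f x)) ∧
      (∀ x, N ≤ x.1 → N ≤ (f x).1) ∧
      (∀ x y, N ≤ x.1 → (f y).1 = (f x).1 → ∃ k, y = shift (m * k) x) := by
  classical
  obtain ⟨N, hN⟩ := (T ∪ T.image τ.1).exists_fst_lt
  let D : Set (ℕ × ℤ) := {x | ∃ s ∈ T, ∃ k, x = shift (m * k) s}
  have hD : ∀ x k, shift (m * k) x ∈ D ↔ x ∈ D := by
    intro x k
    constructor
    · rintro ⟨s, hs, l, h⟩
      refine ⟨s, hs, l - k, ?_⟩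
      rw [shift_eq_iff, shift_shift] at h
      rw [h]
      ring_nf
    · rintro ⟨s, hs, l, rfl⟩
      exact ⟨s, hs, l + k, by rw [shift_shift]; ring_nf⟩
  have hDN : ∀ x ∈ D, x.1 < N := by
    rintro _ ⟨s, hs, l, rfl⟩
    exact hN s (Finset.mem_union_left _ hs)
  have hDN' : ∀ x ∈ D, (τ.1 x).1 < N := by
    rintro _ ⟨s, hs, l, rfl⟩
    rw [τ.zpow_shift]
    exact hN (τ.1 s) (Finset.mem_union_right _ (Finset.mem_image_of_mem _ hs))
  -- Outside `D`, the new line encodes the old line and the residue mod `m`, that is, the `m`-orbit.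
  -- Adding `N` avoids the lines met by `T` and its image, and `n` times the quotient turns steps of
  -- `m` into steps of `n`.
  let f : ℕ × ℤ → ℕ × ℤ := fun x =>
    if x ∈ D then τ.1 x else (N + Nat.pair x.1 (x.2 % m).toNat, n * (x.2 / m))
  have f1 : ∀ x ∈ D, f x = τ.1 x := fun x h => if_pos h
  have f2 : ∀ x, x ∉ D → f x = (N + Nat.pair x.1 (x.2 % m).toNat, n * (x.2 / m)) :=
    fun x h => if_neg h
  have f3 : ∀ x, x ∉ D → N ≤ (f x).1 := fun x h => by simp [f2 x h]
  have hcode : ∀ x y, x ∉ D → y ∉ D → (f y).1 = (f x).1 →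
      y = shift (m * (y.2 / m - x.2 / m)) x := by
    intro x y hx hy h
    simp only [f2 x hx, f2 y hy, add_right_inj, Nat.pair_eq_pair] at h
    have h1 := Int.emod_nonneg x.2 hm
    have h2 := Int.emod_nonneg y.2 hm
    have h3 : y.2 % m = x.2 % m := by lia
    refine Prod.ext h.1 ?_
    rw [shift_snd, mul_sub]
    have h4 := Int.emod_add_mul_ediv x.2 m
    have h5 := Int.emod_add_mul_ediv y.2 m
    lia
  refine ⟨N, f, fun x hx => f1 x ⟨x, hx, 0, by simp⟩, ?_, ?_, ?_⟩
  · intro x y k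
    by_cases hx : x ∈ D
    · by_cases hy : y ∈ D
      · rw [f1 x hx, f1 y hy, ← τ.zpow_shift, τ.1.injective.eq_iff]
      · refine iff_of_false (fun h => hy (h ▸ (hD x k).2 hx)) fun h => ?_
        have h1 := f3 y hy
        rw [h, shift_fst, f1 x hx] at h1
        exact absurd (hDN' x hx) h1.not_gt
    · by_cases hy : y ∈ D
      · refine iff_of_false (fun h => hx ((hD x k).1 (h ▸ hy))) fun h => ?_
        have h1 := f3 x hx
        rw [← shift_fst (n * k), ← h, f1 y hy] at h1
        exact absurd (hDN' y hy) h1.not_gt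
      · constructor
        · rintro rfl
          rw [f2 x hx, f2 _ hy]
          ext
          · simp
          · simp [Int.add_mul_ediv_left _ _ hm, mul_add]
        · intro h
          have h1 := hcode x y hx hy (by rw [h, shift_fst])
          have h2 := congrArg Prod.snd h
          rw [shift_snd, f2 x hx, f2 y hy] at h2
          simp only [← mul_add] at h2
          have h3 := mul_left_cancel₀ hn h2
          rw [h1, h3]
          congr 1
          have h4 : (shift (m * (x.2 / m + k - x.2 / m)) x).2 / m = x.2 / m + k := by
            rw [shift_snd, Int.add_mul_ediv_left _ _ hm]
            ring
          ring_nf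
  · exact fun x hx => f3 x fun h => absurd (hDN x h) hx.not_gt
  · intro x y hx h
    have hx' : x ∉ D := fun h => absurd (hDN x h) hx.not_gt
    have hy' : y ∉ D := fun hy => by
      have := hDN' y hy
      rw [← f1 y hy, h] at this
      exact absurd this (f3 x hx').not_gt
    exact ⟨_, hcode x y hx' hy' h⟩

/-- Apply, for the successive entries `e` of `w`, the shift by `e` followed by `f`. -/
def runWord (f : ℕ × ℤ → ℕ × ℤ) (w : List ℤ) (x : ℕ × ℤ) : ℕ × ℤ :=
  w.foldl (fun x e => f (shift e x)) x

@[simp] theorem runWord_nil (f : ℕ × ℤ → ℕ × ℤ) (x : ℕ × ℤ) : runWord f [] x = x := rfl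

@[simp] theorem runWord_cons (f : ℕ × ℤ → ℕ × ℤ) (e : ℤ) (w : List ℤ) (x : ℕ × ℤ) :
    runWord f (e :: w) x = runWord f w (f (shift e x)) := rfl

@[simp] theorem runWord_append (f : ℕ × ℤ → ℕ × ℤ) (w w' : List ℤ) (x : ℕ × ℤ) :
    runWord f (w ++ w') x = runWord f w' (runWord f w x) := by
  simp [runWord]

section Spread

variable {m n : ℤ} {N : ℕ} {f : ℕ × ℤ → ℕ × ℤ}

theorem runWord_injective (hf : ∀ x y k, y = shift (m * k) x ↔ f y = shift (n * k) (f x))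
    (w : List ℤ) : Function.Injective (runWord f w) := by
  have hinj : Function.Injective f := fun x y h => by simpa using (hf y x 0).2 (by simpa using h)
  induction w with
  | nil => exact Function.injective_id
  | cons e w ih => exact ih.comp (hinj.comp (shift_injective e))

theorem le_runWord_fst (hN : ∀ x, N ≤ x.1 → N ≤ (f x).1) (w : List ℤ) :
    ∀ x, N ≤ x.1 → N ≤ (runWord f w x).1 := by
  induction w with
  | nil => exact fun x hx => hx
  | cons e w ih => exact fun x hx => ih _ (hN _ hx)

/-- Otherwise the set `R` of lines reachable from `p` is finite and preserved by `f`. Then `f`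
injects its `|R| * |m|` many `m`-orbits into its `|R| * |n|` many `n`-orbits, contradicting `|n| <
|m|`. -/
theorem exists_le_runWord_fst (hmn : |n| < |m|) (hn : n ≠ 0)
    (hf : ∀ x y k, y = shift (m * k) x ↔ f y = shift (n * k) (f x)) (N : ℕ) (p : ℕ × ℤ) :
    ∃ w, N ≤ (runWord f w p).1 := by
  classical
  by_contra! hcon
  let R : Finset ℕ := (Finset.range N).filter fun i => ∃ w, (runWord f w p).1 = i
  have hR : ∀ w, (runWord f w p).1 ∈ R := fun w => by
    simp only [R, Finset.mem_filter, Finset.mem_range]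
    exact ⟨hcon w, w, rfl⟩
  have hRf : ∀ x : ℕ × ℤ, x.1 ∈ R → (f x).1 ∈ R := by
    intro x hx
    obtain ⟨w, hw⟩ := (Finset.mem_filter.1 hx).2
    obtain ⟨k, hk⟩ := exists_eq_shift hw.symm
    have := hR (w ++ [k])
    rwa [runWord_append, runWord_cons, ← hk, runWord_nil] at this
  have hm : m ≠ 0 := by
    rintro rfl
    simp only [abs_zero] at hmn
    exact absurd (abs_nonneg n) hmn.not_ge
  -- The interval `Ico 0 |m|` meets each `m`-orbit of a line once, and the residue mod `n` names the
  -- `n`-orbit of the image.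
  have hcard := Finset.card_le_card_of_injOn (s := R ×ˢ Finset.Ico 0 |m|)
    (t := R ×ˢ Finset.Ico 0 |n|) (fun x => ((f x).1, (f x).2 % n))
    (by
      rintro x hx
      simp only [Finset.coe_product, Set.mem_prod, Finset.mem_coe, Finset.mem_Ico] at hx ⊢
      exact ⟨hRf x hx.1, Int.emod_nonneg _ hn, Int.emod_lt_abs _ hn⟩)
    (by
      intro x hx y hy h
      simp only [Finset.coe_product, Set.mem_prod, Finset.mem_coe, Finset.mem_Ico] at hx hy
      simp only [Prod.mk.injEq] at h
      obtain ⟨k, hk⟩ := Int.ModEq.dvd h.2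
      have h1 := (hf x y k).2 (Prod.ext h.1.symm (by rw [shift_snd]; lia))
      have h2 : m * k = 0 := by
        have h3 : y.2 = x.2 + m * k := congrArg Prod.snd h1
        refine Int.eq_zero_of_abs_lt_dvd ((abs_dvd m _).2 (dvd_mul_right m k)) ?_
        rw [abs_lt]
        constructor <;> linarith
      rw [h1, h2, shift_zero])
  simp only [Finset.card_product, Int.card_Ico, sub_zero] at hcard
  have h1 : 0 < R.card := Finset.card_pos.2 ⟨_, hR []⟩
  have h2 := Nat.le_of_mul_le_mul_left hcard h1
  have := abs_nonneg n
  lia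

/-- Lines from `N` on are never left again, so words that free one point after another can be
concatenated. -/
theorem exists_le_runWord_fst_of_finset (hmn : |n| < |m|) (hn : n ≠ 0)
    (hf : ∀ x y k, y = shift (m * k) x ↔ f y = shift (n * k) (f x))
    (hN : ∀ x, N ≤ x.1 → N ≤ (f x).1) (P : Finset (ℕ × ℤ)) :
    ∃ w, ∀ p ∈ P, N ≤ (runWord f w p).1 := by
  classical
  induction P using Finset.induction_on with
  | empty => exact ⟨[], by simp⟩
  | insert p P _ ih =>
    obtain ⟨w, hw⟩ := ih
    obtain ⟨w', hw'⟩ := exists_le_runWord_fst hmn hn hf N (runWord f w p)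
    refine ⟨w ++ w', fun q hq => ?_⟩
    rw [runWord_append]
    obtain rfl | hq := Finset.mem_insert.1 hq
    · exact hw'
    · exact le_runWord_fst hN _ _ (hw q hq)

/-- By `hsep`, when one of the points is beyond `N`, images on a common line come from a common
`m`-orbit, hence from a common line. -/
theorem runWord_fst_ne (hN : ∀ x, N ≤ x.1 → N ≤ (f x).1)
    (hsep : ∀ x y, N ≤ x.1 → (f y).1 = (f x).1 → ∃ k, y = shift (m * k) x) (w : List ℤ) :
    ∀ x y, N ≤ x.1 → x.1 ≠ y.1 → (runWord f w x).1 ≠ (runWord f w y).1 := by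
  induction w with
  | nil => exact fun x y _ h => h
  | cons e w ih =>
    refine fun x y hx h => ih _ _ (hN _ hx) fun h' => ?_
    obtain ⟨k, hk⟩ := hsep (shift e x) (shift e y) hx h'.symm
    exact h (congrArg Prod.fst hk).symm

/-- If `f` does not separate the two points, they differ by `m * k` on one line and their images by
`n * k`, which is strictly smaller since `k ≠ 0`. Descent on the distance ends in separation. -/
theorem exists_runWord_fst_ne (hmn : |n| < |m|)
    (hf : ∀ x y k, y = shift (m * k) x ↔ f y = shift (n * k) (f x))
    (hN : ∀ x, N ≤ x.1 → N ≤ (f x).1)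
    (hsep : ∀ x y, N ≤ x.1 → (f y).1 = (f x).1 → ∃ k, y = shift (m * k) x) (d : ℕ) :
    ∀ x y, N ≤ x.1 → x ≠ y → (y.2 - x.2).natAbs = d →
      ∃ w, (runWord f w x).1 ≠ (runWord f w y).1 := by
  induction d using Nat.strong_induction_on with
  | _ d ih =>
    intro x y hx hxy hd
    by_cases h : (f y).1 = (f x).1
    · obtain ⟨k, rfl⟩ := hsep x y hx h
      have hk : k ≠ 0 := by
        rintro rfl
        simp at hxy
      have hfy := (hf x _ k).1 rfl
      have hlt : ((f (shift (m * k) x)).2 - (f x).2).natAbs < d := by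
        rw [hfy, ← hd]
        simp only [shift_snd, add_sub_cancel_left, Int.natAbs_mul]
        rw [Int.abs_eq_natAbs, Int.abs_eq_natAbs] at hmn
        exact Nat.mul_lt_mul_of_pos_right (by exact_mod_cast hmn) (Int.natAbs_pos.2 hk)
      obtain ⟨w, hw⟩ := ih _ hlt (f x) (f (shift (m * k) x)) (hN x hx)
        (fun he => hxy (by simpa using runWord_injective hf [0] (by simpa using he))) rfl
      exact ⟨0 :: w, by simpa using hw⟩
    · exact ⟨[0], by simpa using Ne.symm h⟩

theorem exists_runWord_fst_ne_of_finset (hmn : |n| < |m|)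
    (hf : ∀ x y k, y = shift (m * k) x ↔ f y = shift (n * k) (f x))
    (hN : ∀ x, N ≤ x.1 → N ≤ (f x).1)
    (hsep : ∀ x y, N ≤ x.1 → (f y).1 = (f x).1 → ∃ k, y = shift (m * k) x)
    (Q : Finset ((ℕ × ℤ) × (ℕ × ℤ))) (hQ : ∀ q ∈ Q, N ≤ q.1.1 ∧ q.1 ≠ q.2) :
    ∃ w, ∀ q ∈ Q, (runWord f w q.1).1 ≠ (runWord f w q.2).1 := by
  classical
  induction Q using Finset.induction_on with
  | empty => exact ⟨[], by simp⟩
  | insert q Q _ ih =>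
    obtain ⟨w, hw⟩ := ih fun q hq => hQ q (Finset.mem_insert_of_mem hq)
    have hq := hQ q (Finset.mem_insert_self _ _)
    obtain ⟨w', hw'⟩ := exists_runWord_fst_ne hmn hf hN hsep _ (runWord f w q.1) (runWord f w q.2)
      (le_runWord_fst hN _ _ hq.1) ((runWord_injective hf w).ne hq.2) rfl
    refine ⟨w ++ w', fun r hr => ?_⟩
    rw [runWord_append, runWord_append]
    obtain rfl | hr' := Finset.mem_insert.1 hr
    · exact hw'
    · exact runWord_fst_ne hN hsep _ _ _ (le_runWord_fst hN _ _ (hQ r hr).1) (hw r hr')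

/-- A word moves finitely many points to distinct lines, to the neighbours of which nothing is
sent by `f`. -/
theorem exists_runWord_separating (hmn : |n| < |m|) (hn : 2 ≤ |n|)
    (hf : ∀ x y k, y = shift (m * k) x ↔ f y = shift (n * k) (f x))
    (hN : ∀ x, N ≤ x.1 → N ≤ (f x).1)
    (hsep : ∀ x y, N ≤ x.1 → (f y).1 = (f x).1 → ∃ k, y = shift (m * k) x)
    (P : Finset (ℕ × ℤ)) :
    ∃ w, (∀ p ∈ P, ∀ x, f x ≠ shift 1 (runWord f w p)) ∧
      ∀ p ∈ P, ∀ q ∈ P, p ≠ q → (runWord f w p).1 ≠ (runWord f w q).1 := by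
  classical
  have hn0 : n ≠ 0 := by
    rintro rfl
    simp at hn
  obtain ⟨w, hw⟩ := exists_le_runWord_fst_of_finset hmn hn0 hf hN P
  obtain ⟨w', hw'⟩ := exists_runWord_fst_ne_of_finset hmn hf hN hsep
    (P.offDiag.image (Prod.map (runWord f w) (runWord f w))) (by
      intro q hq
      obtain ⟨⟨p, p'⟩, hp, rfl⟩ := Finset.mem_image.1 hq
      simp only [Finset.mem_offDiag] at hp
      exact ⟨hw p hp.1, (runWord_injective hf w).ne hp.2.2⟩)
  have hN1 : ∀ p ∈ P, N ≤ (runWord f (w ++ w') p).1 := fun p hp => by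
    rw [runWord_append]
    exact le_runWord_fst hN _ _ (hw p hp)
  -- The final letter `0` applies `f` once more: the end points then lie in the image of `f`, whose
  -- points on such a line differ by multiples of `n`. As `|n| ≥ 2`, the neighbour at distance 1 is
  -- not in the image.
  refine ⟨w ++ w' ++ [0], fun p hp x hx => ?_, fun p hp q hq hpq => ?_⟩
  · rw [runWord_append, runWord_cons, runWord_nil, shift_zero] at hx
    obtain ⟨k, hk⟩ := hsep (runWord f (w ++ w') p) x (hN1 p hp) (by rw [hx, shift_fst])
    have h1 := (hf _ _ k).1 hk
    rw [hx] at h1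
    have h2 : n * k = 1 := (shift_left_injective _ h1).symm
    have := Int.isUnit_iff_abs_eq.1 (IsUnit.of_mul_eq_one _ h2)
    lia
  · rw [runWord_append f (w ++ w'), runWord_append f (w ++ w')]
    refine runWord_fst_ne hN hsep _ _ _ (hN1 p hp) ?_
    have := hw' (runWord f w p, runWord f w q) (Finset.mem_image.2 ⟨(p, q), by simp [hp, hq, hpq], rfl⟩)
    simpa using this

end Spread

/-! ### Density of transitivity -/

namespace BaumslagSolitar

variable {m n : ℤ}

/-- The group element acting as the word `w` does. -/
def ofWord : List ℤ → BaumslagSolitar m n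
  | [] => 1
  | e :: w => ofWord w * (a * b ^ e)

theorem rep_ofWord (f : ℕ × ℤ → ℕ × ℤ) (w : List ℤ) : ∀ x, ∃ V : Finset (ℕ × ℤ),
    ∀ τ : EquivariantPerm m n, (∀ v ∈ V, τ.1 v = f v) → rep τ (ofWord w) x = runWord f w x := by
  classical
  induction w with
  | nil => exact fun x => ⟨∅, fun τ _ => by simp [ofWord]⟩
  | cons e w ih =>
    intro x
    obtain ⟨V, hV⟩ := ih (f (shift e x))
    refine ⟨insert (shift e x) V, fun τ h => ?_⟩
    rw [ofWord, map_mul, map_mul, Equiv.Perm.mul_apply, Equiv.Perm.mul_apply, rep_b_zpow, rep_a,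
      h _ (Finset.mem_insert_self _ _), hV τ fun v hv => h v (Finset.mem_insert_of_mem hv),
      runWord_cons]

/-- Any equivariant permutation can be changed outside a finite set so that some group element
takes given points to given other points. -/
theorem exists_agreeOn_transport (hmn : |n| < |m|) (hn : 2 ≤ |n|) (τ : EquivariantPerm m n)
    (S : Finset (ℕ × ℤ)) {k : ℕ} (x y : Fin k ↪ ℕ × ℤ) (hxy : ∀ i j, x i ≠ y j) :
    ∃ τ', AgreeOn S τ τ' ∧ ∃ g, ∀ i, rep τ' g (x i) = y i := by
  classical
  have hn0 : n ≠ 0 := by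
    rintro rfl
    simp at hn
  have hm0 : m ≠ 0 := by
    rintro rfl
    rw [abs_zero] at hmn
    exact absurd (abs_nonneg n) hmn.not_ge
  let T := S ∪ S.image ⇑(τ.1⁻¹)
  obtain ⟨N, f, hfT, hf, hN, hsep⟩ := τ.exists_spread hm0 hn0 T
  -- Sources (`false`) and targets (`true`) are spread together by one word.
  let p : Fin k × Bool → ℕ × ℤ := fun q => if q.2 then y q.1 else x q.1
  have hp : Function.Injective p := by
    rintro ⟨i, _ | _⟩ ⟨j, _ | _⟩ h
    · simpa [p] using h
    · exact absurd h (by simpa [p] using hxy i j)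
    · exact absurd h (by simpa [p] using (hxy j i).symm)
    · simpa [p] using h
  obtain ⟨w, hw1, hw2⟩ := exists_runWord_separating hmn hn hf hN hsep (Finset.univ.image p)
  have hpm : ∀ q, p q ∈ Finset.univ.image p := fun q =>
    Finset.mem_image_of_mem _ (Finset.mem_univ q)
  choose V hV using fun q => rep_ofWord (m := m) (n := n) f w (p q)
  let U : Finset (ℕ × ℤ) := T ∪ Finset.univ.biUnion V
  obtain ⟨M, hM⟩ := U.exists_fst_lt
  let u : Fin k × Bool → ℕ × ℤ := fun q => shift 1 (runWord f w (p q))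
  have hu : ∀ q x, f x ≠ u q := fun q => hw1 _ (hpm q)
  have huu : ∀ q q', (u q).1 = (u q').1 → q = q' := by
    intro q q' h
    by_contra hne
    exact hw2 _ (hpm q) _ (hpm q') (hp.ne hne) h
  -- These become the preimages of the points `u q` under `a`: for each `i` the two flags give
  -- neighbours on a fresh line, exchangeable by one step of `b`.
  let z : Fin k × Bool → ℕ × ℤ := fun q => (M + q.1, if q.2 then 1 else 0)
  let s : {v // v ∈ U} ⊕ (Fin k × Bool) → ℕ × ℤ := Sum.elim Subtype.val z
  let t : {v // v ∈ U} ⊕ (Fin k × Bool) → ℕ × ℤ := Sum.elim (fun v => f v) u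
  have hst : ∀ p q l, s q = shift (m * l) (s p) ↔ t q = shift (n * l) (t p) := by
    rintro (⟨v, hv⟩ | q) (⟨v', hv'⟩ | q') l
    · exact hf v v' l
    · refine iff_of_false (fun h => ?_) fun h => ?_
      · have h1 := congrArg Prod.fst h
        simp only [s, z, Sum.elim_inl, Sum.elim_inr, shift_fst] at h1
        have := hM v hv
        lia
      · exact hu q' (shift (m * l) v) (((hf v _ l).1 rfl).trans h.symm)
    · refine iff_of_false (fun h => ?_) fun h => ?_
      · have h1 := congrArg Prod.fst h
        simp only [s, z, Sum.elim_inl, Sum.elim_inr, shift_fst] at h1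
        have := hM v' hv'
        lia
      · simp only [t, Sum.elim_inl, Sum.elim_inr] at h
        rw [eq_comm, shift_eq_iff] at h
        refine hu q (shift (m * -l) v') ?_
        rw [(hf v' _ (-l)).1 rfl, h, mul_neg]
    · obtain ⟨i, c⟩ := q
      obtain ⟨j, d⟩ := q'
      have h2 : (s (.inr (j, d)) = shift (m * l) (s (.inr (i, c)))) ↔ ((i, c) = (j, d) ∧ l = 0) := by
        -- Two neighbours on a line lie in different `m`-orbits because `|m| ≥ 2`, so their images
        -- can be prescribed independently.
        have hm2 : ¬ IsUnit m := fun h => by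
          have := Int.isUnit_iff_abs_eq.1 h
          lia
        constructor
        · intro h
          simp only [s, z, Sum.elim_inr, shift, Prod.mk.injEq, add_right_inj] at h
          obtain ⟨h1, h3⟩ := h
          obtain rfl := Fin.val_injective h1
          cases c <;> cases d <;> simp at h3 ⊢
          · tauto
          · exact hm2 (IsUnit.of_mul_eq_one _ h3.symm)
          · exact hm2 (IsUnit.of_mul_eq_one (-l) (by rw [mul_neg]; lia))
          · tauto
        · rintro ⟨h, rfl⟩
          rw [← h, mul_zero, shift_zero]
      have h3 : (t (.inr (j, d)) = shift (n * l) (t (.inr (i, c)))) ↔ ((i, c) = (j, d) ∧ l = 0) := by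
        constructor
        · intro h
          have h1 : (j, d) = (i, c) := huu _ _ (congrArg Prod.fst h :)
          refine ⟨h1.symm, ?_⟩
          rw [h1] at h
          have := shift_left_injective _ (h.symm.trans (shift_zero _).symm)
          simpa [hn0] using this
        · rintro ⟨h, rfl⟩
          rw [← h, mul_zero, shift_zero]
      rw [h2, h3]
  obtain ⟨τ', h1, h2⟩ := exists_equivariant_perm hm0 hn0 s t hst
    (infinite_setOf_fst_ne s) (infinite_setOf_fst_ne t)
  have hU : ∀ v ∈ U, τ' v = f v := fun v hv => h2 (.inl ⟨v, hv⟩)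
  have hz : ∀ q, τ' (z q) = u q := fun q => h2 (.inr q)
  let σ : EquivariantPerm m n := ⟨τ', h1⟩
  -- Read from the right: spread by `w`, step by `b` off the image of `f`, pull back by `a⁻¹` to the
  -- fresh line, step from the source's preimage to the target's, and retrace.
  refine ⟨σ, agreeOn_of_eqOn fun v hv => ?_,
    (ofWord w)⁻¹ * b⁻¹ * a * b * a⁻¹ * b * ofWord w, fun i => ?_⟩
  · exact (hU v (Finset.mem_union_left _ hv)).trans (hfT v hv)
  · have hr : ∀ q, rep σ (b * ofWord w) (p q) = rep σ a (z q) := fun q => by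
      rw [map_mul, Equiv.Perm.mul_apply, hV q σ fun v hv => hU v (Finset.mem_union_right _
        (Finset.mem_biUnion.2 ⟨q, Finset.mem_univ q, hv⟩)), rep_b, rep_a]
      exact (hz q).symm
    have hx : rep σ (b * ofWord w) (x i) = rep σ a (z (i, false)) := hr (i, false)
    have hy : rep σ (b * ofWord w) (y i) = rep σ a (z (i, true)) := hr (i, true)
    have hb : rep σ b (z (i, false)) = z (i, true) := by
      rw [rep_b]
      simp [z, shift]
    have hg : ((ofWord w)⁻¹ * b⁻¹ * a * b * a⁻¹ * b * ofWord w : BaumslagSolitar m n) =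
        (b * ofWord w)⁻¹ * (a * (b * (a⁻¹ * (b * ofWord w)))) := by group
    rw [hg, map_mul, Equiv.Perm.mul_apply, map_inv, Equiv.Perm.inv_eq_iff_eq, hy, map_mul,
      Equiv.Perm.mul_apply, map_mul, Equiv.Perm.mul_apply, map_mul, Equiv.Perm.mul_apply, hx,
      map_inv, Equiv.Perm.inv_def, Equiv.symm_apply_apply, hb]

/-! ### The affine action on the rationals -/

theorem addRight_one_zpow_apply (k : ℤ) (x : ℚ) :
    ((Equiv.addRight (1 : ℚ)) ^ k : Equiv.Perm ℚ) x = x + k := by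
  have h1 : ∀ y : ℚ, (Equiv.addRight (1 : ℚ))⁻¹ y = y - 1 := fun y => by
    rw [Equiv.Perm.inv_eq_iff_eq]
    simp
  induction k generalizing x with
  | zero => simp
  | succ k ih =>
    rw [zpow_add_one, Equiv.Perm.mul_apply, ih]
    push_cast [Equiv.coe_addRight]
    ring
  | pred k ih =>
    rw [zpow_sub_one, Equiv.Perm.mul_apply, ih, h1]
    push_cast
    ring

/-- The affine action on `ℚ`, in which `b` is the translation by `1` and `a` is the homothety of
ratio `n / m`. -/
noncomputable def affineRep (hm : m ≠ 0) (hn : n ≠ 0) : BaumslagSolitar m n →* Equiv.Perm ℚ :=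
  lift (Equiv.mulLeft₀ (n / m : ℚ) (by positivity)) (Equiv.addRight 1) (by
    rw [mul_inv_eq_iff_eq_mul]
    ext1 x
    have : (m : ℚ) ≠ 0 := by exact_mod_cast hm
    rw [Equiv.Perm.mul_apply, Equiv.Perm.mul_apply, addRight_one_zpow_apply,
      addRight_one_zpow_apply]
    simp only [Equiv.mulLeft₀_apply]
    field_simp)

theorem affineRep_b_zpow (hm : m ≠ 0) (hn : n ≠ 0) (k : ℤ) (x : ℚ) :
    affineRep hm hn (b ^ k) x = x + k := by
  rw [map_zpow, affineRep, lift_b, addRight_one_zpow_apply]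

theorem exists_affineRep_apply (hm : m ≠ 0) (hn : n ≠ 0) (g : BaumslagSolitar m n) :
    ∃ (i : ℤ) (c : ℚ), ∀ x, affineRep hm hn g x = (n / m : ℚ) ^ i * x + c := by
  have hr : (n / m : ℚ) ≠ 0 := by positivity
  induction g using induction with
  | ha => exact ⟨1, 0, fun x => by simp [affineRep]⟩
  | hb => exact ⟨0, 1, fun x => by simpa using affineRep_b_zpow hm hn 1 x⟩
  | hmul g h hg hh =>
    obtain ⟨i, c, hi⟩ := hg
    obtain ⟨j, d, hj⟩ := hh
    refine ⟨i + j, (n / m : ℚ) ^ i * d + c, fun x => ?_⟩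
    rw [map_mul, Equiv.Perm.mul_apply, hj, hi, zpow_add₀ hr]
    ring
  | hinv g hg =>
    obtain ⟨i, c, hi⟩ := hg
    refine ⟨-i, -((n / m : ℚ) ^ (-i) * c), fun x => ?_⟩
    rw [map_inv, Equiv.Perm.inv_eq_iff_eq, hi, mul_add, mul_neg, ← mul_assoc, ← mul_assoc,
      ← zpow_add₀ hr]
    simp

theorem b_zpow_eq_one_iff (hm : m ≠ 0) (hn : n ≠ 0) {k : ℤ} :
    (b ^ k : BaumslagSolitar m n) = 1 ↔ k = 0 := by
  refine ⟨fun h => ?_, fun h => by simp [h]⟩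
  have := affineRep_b_zpow hm hn k 0
  rw [h] at this
  simpa using this.symm

/-- If two powers of `b` are conjugate, the quotient of the exponents is a power of `n / m`. -/
theorem exists_zpow_eq_of_conj (hm : m ≠ 0) (hn : n ≠ 0) {g : BaumslagSolitar m n} {k l : ℤ}
    (h : g * b ^ k * g⁻¹ = b ^ l) : ∃ i : ℤ, (n / m : ℚ) ^ i * k = l := by
  obtain ⟨i, c, hi⟩ := exists_affineRep_apply hm hn g
  refine ⟨i, ?_⟩
  rw [mul_inv_eq_iff_eq_mul] at h
  have h1 := congrArg (fun x => affineRep hm hn x 0) h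
  simp only [map_mul, Equiv.Perm.mul_apply, affineRep_b_zpow, hi] at h1
  linarith

/-! ### Density of free orbits and the generic action -/

/-- Any equivariant permutation can be changed outside a finite set so that the group acts freely on
the orbit of some point. -/
theorem exists_agreeOn_free (hm : m ≠ 0) (hn : n ≠ 0) (τ : EquivariantPerm m n)
    (S E : Finset (ℕ × ℤ)) :
    ∃ τ', AgreeOn S τ τ' ∧ ∃ x ∉ E, ∀ g ≠ 1, rep τ' g x ≠ x := by
  classical
  let T := S ∪ S.image ⇑(τ.1⁻¹)
  obtain ⟨N, hN⟩ := (E ∪ (T ∪ T.image τ.1)).exists_fst_lt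
  let α : Equiv.Perm (BaumslagSolitar m n) := Equiv.mulLeft b
  have hα : ∀ (k : ℤ) g, (α ^ k) g = b ^ k * g := fun k g => by
    simp [α, Equiv.zpow_mulLeft]
  obtain ⟨e, he⟩ := exists_equiv_of_free α fun g k h => by
    rw [hα, mul_eq_right] at h
    exact (b_zpow_eq_one_iff hm hn).1 h
  have : Countable (Quotient (Equiv.Perm.SameCycle.setoid α)) := Quotient.countable
  obtain ⟨enc, henc⟩ := exists_injective_nat (Quotient (Equiv.Perm.SameCycle.setoid α))
  -- The right cosets of the powers of `b` go to lines of even offset above `N`; the odd offsets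
  -- stay free for extending to a permutation.
  let c : BaumslagSolitar m n → ℕ × ℤ := fun g => (N + 2 * enc (e g).1, (e g).2)
  have hc : Function.Injective c := by
    intro g h hgh
    simp only [c, Prod.mk.injEq, add_right_inj, mul_right_inj' two_ne_zero] at hgh
    exact e.injective (Prod.ext (henc hgh.1) hgh.2)
  have hcb : ∀ (k : ℤ) g, c (b ^ k * g) = shift k (c g) := by
    intro k g
    simp only [c, ← hα, he, shift]
  let s : {v // v ∈ T} ⊕ BaumslagSolitar m n → ℕ × ℤ := Sum.elim Subtype.val c
  let t : {v // v ∈ T} ⊕ BaumslagSolitar m n → ℕ × ℤ := Sum.elim (fun v => τ.1 v) fun g => c (a * g)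
  have hT : ∀ v ∈ T, v.1 < N := fun v hv =>
    hN v (Finset.mem_union_right _ (Finset.mem_union_left _ hv))
  have hT' : ∀ v ∈ T, (τ.1 v).1 < N := fun v hv => hN _ (Finset.mem_union_right _
    (Finset.mem_union_right _ (Finset.mem_image_of_mem _ hv)))
  have hcN : ∀ g, N ≤ (c g).1 := fun g => Nat.le_add_right _ _
  have hst : ∀ p q l, s q = shift (m * l) (s p) ↔ t q = shift (n * l) (t p) := by
    rintro (⟨v, hv⟩ | g) (⟨v', hv'⟩ | h) l
    · simp only [s, t, Sum.elim_inl]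
      rw [← τ.zpow_shift, τ.1.injective.eq_iff]
    · refine iff_of_false (fun he => ?_) fun he => ?_
      · exact (hT v hv).not_ge ((hcN h).trans_eq (congrArg Prod.fst he :))
      · exact (hT' v hv).not_ge ((hcN _).trans_eq (congrArg Prod.fst he :))
    · refine iff_of_false (fun he => ?_) fun he => ?_
      · exact (hT v' hv').not_ge ((hcN g).trans_eq (congrArg Prod.fst he :).symm)
      · exact (hT' v' hv').not_ge ((hcN _).trans_eq (congrArg Prod.fst he :).symm)
    · simp only [s, t, Sum.elim_inr]
      -- Left multiplication by `a` is consistent with the translations because `a * b ^ (m * l) = b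
      -- ^ (n * l) * a`.
      rw [← hcb, ← hcb, hc.eq_iff, hc.eq_iff, zpow_mul b n, ← relation, conj_zpow, ← zpow_mul,
        ← mul_assoc _ a g, inv_mul_cancel_right, mul_assoc a _ g, mul_right_inj]
  have hodd : ∀ r : {v // v ∈ T} ⊕ BaumslagSolitar m n → ℕ × ℤ, (∀ v, (r (.inl v)).1 < N) →
      (∀ g, ∃ h, r (.inr g) = c h) → {i : ℕ | ∀ p, (r p).1 ≠ i}.Infinite := by
    intro r h1 h2
    refine Set.infinite_of_injective_forall_mem (f := fun i : ℕ => N + 2 * i + 1)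
      (fun i j h => by simpa using h) ?_
    rintro i (v | g) h
    · have := h1 v
      lia
    · obtain ⟨h', hh⟩ := h2 g
      rw [hh] at h
      simp only [c] at h
      lia
  obtain ⟨τ', h1, h2⟩ := exists_equivariant_perm hm hn s t hst
    (hodd s (fun v => hT v v.2) fun g => ⟨g, rfl⟩)
    (hodd t (fun v => hT' v v.2) fun g => ⟨a * g, rfl⟩)
  let σ : EquivariantPerm m n := ⟨τ', h1⟩
  have hfree : ∀ g h, rep σ g (c h) = c (g * h) := by
    intro g
    induction g using induction with
    | ha => exact fun h => (rep_a _ _).trans (h2 (.inr h))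
    | hb => exact fun h => by simpa [rep_b] using (hcb 1 h).symm
    | hmul g g' hg hg' =>
      intro h
      rw [map_mul, Equiv.Perm.mul_apply, hg', hg, mul_assoc g g' h]
    | hinv g hg =>
      intro h
      rw [map_inv, Equiv.Perm.inv_eq_iff_eq, hg, mul_inv_cancel_left]
  refine ⟨σ, agreeOn_of_eqOn fun v hv => h2 (.inl ⟨v, hv⟩), c 1, fun hE => ?_, fun g hg h => ?_⟩
  · exact (hN _ (Finset.mem_union_left _ hE)).not_ge (hcN 1)
  · rw [hfree, hc.eq_iff, mul_one] at h
    exact hg h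

/-- If `2 ≤ |n| < |m|`, some action on `ℕ × ℤ` is highly transitive and highly faithful. -/
theorem exists_rep_of_lt (hmn : |n| < |m|) (hn : 2 ≤ |n|) :
    ∃ ρ : BaumslagSolitar m n →* Equiv.Perm (ℕ × ℤ),
      (∀ k : ℕ, ∀ x y : Fin k ↪ ℕ × ℤ, ∃ g, ∀ i, ρ g (x i) = y i) ∧
      ∀ F : Finset (BaumslagSolitar m n), 1 ∉ F → {x | ∀ g ∈ F, ρ g x ≠ x}.Infinite := by
  classical
  have hn0 : n ≠ 0 := by
    rintro rfl
    simp at hn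
  have hm0 : m ≠ 0 := by
    rintro rfl
    rw [abs_zero] at hmn
    exact absurd (abs_nonneg n) hmn.not_ge
  -- Countably many conditions: `A` asks for transport between disjoint tuples, `B` for a point
  -- outside a given finite set that is moved by all of `F`.
  let A := {q : Σ k : ℕ, (Fin k → ℕ × ℤ) × (Fin k → ℕ × ℤ) // Function.Injective q.2.1 ∧
    Function.Injective q.2.2 ∧ ∀ i j, q.2.1 i ≠ q.2.2 j}
  let B := {F : Finset (BaumslagSolitar m n) // 1 ∉ F} × Finset (ℕ × ℤ)
  let O : A ⊕ B → Set (EquivariantPerm m n)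
    | .inl q => {τ | ∃ g, ∀ i, rep τ g (q.1.2.1 i) = q.1.2.2 i}
    | .inr q => {τ | ∃ x ∉ q.2, ∀ g ∈ q.1.1, rep τ g x ≠ x}
  obtain ⟨τ₀, h₀, -⟩ := exists_equivariant_perm hm0 hn0 (ι := Empty) Empty.elim Empty.elim
    (fun p => p.elim) (infinite_setOf_fst_ne _) (infinite_setOf_fst_ne _)
  obtain ⟨τ, hτ⟩ := EquivariantPerm.exists_generic (⟨τ₀, h₀⟩ : EquivariantPerm m n) O (by
    rintro (q | q) τ hτ
    · obtain ⟨g, hg⟩ := hτ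
      choose S hS using fun i => rep_continuous τ g (q.1.2.1 i)
      exact ⟨Finset.univ.biUnion S, fun τ' h => ⟨g, fun i => (hS i τ' (h.mono
        (Finset.subset_biUnion_of_mem S (Finset.mem_univ i)))).trans (hg i)⟩⟩
    · obtain ⟨x, hx, hg⟩ := hτ
      choose S hS using fun g => rep_continuous τ g x
      refine ⟨q.1.1.biUnion S, fun τ' h => ⟨x, hx, fun g hgF => ?_⟩⟩
      rw [hS g τ' (h.mono (Finset.subset_biUnion_of_mem S hgF))]
      exact hg g hgF) (by
    rintro (⟨⟨k, x, y⟩, hx, hy, hxy⟩ | q) τ S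
    · exact exists_agreeOn_transport hmn hn τ S ⟨x, hx⟩ ⟨y, hy⟩ hxy
    · obtain ⟨τ', h1, x, hx, h2⟩ := exists_agreeOn_free hm0 hn0 τ S q.2
      exact ⟨τ', h1, x, hx, fun g hg => h2 g fun h => q.1.2 (h ▸ hg)⟩)
  have hdisj : ∀ (k : ℕ) (x y : Fin k ↪ ℕ × ℤ), (∀ i j, x i ≠ y j) →
      ∃ g, ∀ i, rep τ g (x i) = y i :=
    fun k x y h => hτ (.inl ⟨⟨k, x, y⟩, x.injective, y.injective, h⟩)
  refine ⟨rep τ, fun k x y => ?_, fun F hF => ?_⟩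
  -- Overlapping tuples are handled by passing through a third tuple disjoint from both.
  · have hinf : (Set.range x ∪ Set.range y)ᶜ.Infinite :=
      ((Set.finite_range x).union (Set.finite_range y)).infinite_compl
    let z : Fin k ↪ ℕ × ℤ := ⟨fun i => hinf.natEmbedding _ i, fun i j h =>
      Fin.val_injective ((hinf.natEmbedding _).injective (Subtype.ext h))⟩
    have hz : ∀ i, z i ∉ Set.range x ∪ Set.range y := fun i => (hinf.natEmbedding _ i).2
    obtain ⟨g, hg⟩ := hdisj k x z fun i j h => hz j (.inl ⟨i, h⟩)
    obtain ⟨g', hg'⟩ := hdisj k z y fun i j h => hz i (.inr ⟨j, h.symm⟩)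
    exact ⟨g' * g, fun i => by rw [map_mul, Equiv.Perm.mul_apply, hg, hg']⟩
  · intro hfin
    obtain ⟨x, hx, h⟩ := hτ (.inr (⟨F, hF⟩, hfin.toFinset))
    exact hx (hfin.mem_toFinset.2 h)

/-- `BS(m,n)` is isomorphic to `BS(n,m)`. -/
def swapEquiv : BaumslagSolitar m n ≃* BaumslagSolitar n m :=
  MonoidHom.toMulEquiv
    (lift a⁻¹ b (by rw [← relation]; group))
    (lift a⁻¹ b (by rw [← relation]; group))
    (hom_ext (by simp) (by simp)) (hom_ext (by simp) (by simp))

/-- If `2 ≤ |m|`, `2 ≤ |n|` and `|m| ≠ |n|`, some action is highly transitive and highly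
faithful. -/
theorem admitsHighlyTransitiveHighlyFaithfulAction (hm : m ≠ 0) (hn : n ≠ 0) (hm1 : |m| ≠ 1)
    (hn1 : |n| ≠ 1) (hmn : |m| ≠ |n|) :
    AdmitsHighlyTransitiveHighlyFaithfulAction (BaumslagSolitar m n) := by
  classical
  have hm2 : 2 ≤ |m| := by
    have := abs_pos.2 hm
    lia
  have hn2 : 2 ≤ |n| := by
    have := abs_pos.2 hn
    lia
  obtain ⟨ρ, h1, h2⟩ : ∃ ρ : BaumslagSolitar m n →* Equiv.Perm (ℕ × ℤ),
      (∀ k : ℕ, ∀ x y : Fin k ↪ ℕ × ℤ, ∃ g, ∀ i, ρ g (x i) = y i) ∧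
      ∀ F : Finset (BaumslagSolitar m n), 1 ∉ F → {x | ∀ g ∈ F, ρ g x ≠ x}.Infinite := by
    rcases hmn.lt_or_gt with h | h
    · obtain ⟨ρ, h1, h2⟩ := exists_rep_of_lt h hm2
      refine ⟨ρ.comp swapEquiv.toMonoidHom, fun k x y => ?_, fun F hF => ?_⟩
      · obtain ⟨g, hg⟩ := h1 k x y
        exact ⟨swapEquiv.symm g, fun i => by simpa using hg i⟩
      · refine (h2 (F.image swapEquiv) ?_).mono ?_
        · simpa using hF
        · intro x hx g hg
          exact hx _ (Finset.mem_image_of_mem _ hg)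
    · exact exists_rep_of_lt h hn2
  let act : MulAction (BaumslagSolitar m n) (ℕ × ℤ) := MulAction.compHom _ ρ
  exact ⟨ℕ × ℤ, inferInstance, inferInstance, act, h1, h2⟩

end BaumslagSolitar

/-! ### Group-theoretic consequences of multiple transitivity -/

theorem IsHighlyTransitiveAction.isMultiplyPretransitive {G X : Type*} [Group G] [MulAction G X]
    (h : IsHighlyTransitiveAction G X) (k : ℕ) : MulAction.IsMultiplyPretransitive G X k :=
  ⟨fun x y => by
    obtain ⟨g, hg⟩ := h k x y
    exact ⟨g, Function.Embedding.ext hg⟩⟩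

theorem IsHighlyTransitiveAction.exists_smul_eq_pair {G X : Type*} [Group G] [MulAction G X]
    (h : IsHighlyTransitiveAction G X) {x y x' y' : X} (hxy : x ≠ y) (hxy' : x' ≠ y') :
    ∃ g : G, g • x = x' ∧ g • y = y' :=
  MulAction.is_two_pretransitive_iff.1 (h.isMultiplyPretransitive 2) hxy hxy'

section TwoTransitive

variable {G X : Type*} [Group G] [MulAction G X] [FaithfulSMul G X] {N : Subgroup G} [N.Normal]

/-- A nontrivial normal subgroup of a faithful 2-transitive group is transitive. -/
theorem exists_mem_smul_eq_of_two_transitive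
    (h2 : ∀ {x y x' y' : X}, x ≠ y → x' ≠ y' → ∃ g : G, g • x = x' ∧ g • y = y')
    {h : G} (hN : h ∈ N) (h1 : h ≠ 1) (x y : X) : ∃ k ∈ N, k • x = y := by
  by_cases hxy : x = y
  · exact ⟨1, N.one_mem, by rw [one_smul, hxy]⟩
  · obtain ⟨z, hz⟩ : ∃ z : X, h • z ≠ z := by
      by_contra! hcon
      exact h1 (FaithfulSMul.eq_of_smul_eq_smul fun z : X => by rw [hcon, one_smul])
    obtain ⟨g, hg1, hg2⟩ := h2 hz.symm hxy
    refine ⟨g * h * g⁻¹, ‹N.Normal›.conj_mem h hN g, ?_⟩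
    rw [← hg1, mul_smul, inv_smul_smul, mul_smul, hg2]

/-- An abelian normal subgroup of a faithful 2-transitive group acts freely. -/
theorem eq_of_smul_eq_of_two_transitive
    (h2 : ∀ {x y x' y' : X}, x ≠ y → x' ≠ y' → ∃ g : G, g • x = x' ∧ g • y = y')
    (hcomm : ∀ g ∈ N, ∀ h ∈ N, g * h = h * g) {g h : G} (hg : g ∈ N) (hh : h ∈ N) {x : X}
    (hx : g • x = h • x) : g = h := by
  by_contra hne
  have hmem : h⁻¹ * g ∈ N := N.mul_mem (N.inv_mem hh) hg
  refine hne (FaithfulSMul.eq_of_smul_eq_smul fun y : X => ?_)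
  obtain ⟨k, hk, rfl⟩ := exists_mem_smul_eq_of_two_transitive (N := N) h2 hmem
    (fun h' => hne (inv_mul_eq_one.1 h').symm) x y
  rw [← mul_smul, ← mul_smul, hcomm g hg k hk, hcomm h hh k hk, mul_smul, mul_smul, hx]

/-- The nontrivial elements of an abelian normal subgroup of a faithful 2-transitive group are
conjugate. -/
theorem exists_conj_eq_of_two_transitive [Nonempty X]
    (h2 : ∀ {x y x' y' : X}, x ≠ y → x' ≠ y' → ∃ g : G, g • x = x' ∧ g • y = y')
    (hcomm : ∀ g ∈ N, ∀ h ∈ N, g * h = h * g) {h k : G} (hh : h ∈ N) (hk : k ∈ N) (hh1 : h ≠ 1)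
    (hk1 : k ≠ 1) : ∃ g : G, g * h * g⁻¹ = k := by
  obtain ⟨x⟩ := ‹Nonempty X›
  have hne : ∀ l ∈ N, l ≠ 1 → x ≠ l • x := fun l hl hl1 hx =>
    hl1 (eq_of_smul_eq_of_two_transitive h2 hcomm hl N.one_mem (by rw [one_smul]; exact hx.symm))
  obtain ⟨g, hg1, hg2⟩ := h2 (hne h hh hh1) (hne k hk hk1)
  refine ⟨g, eq_of_smul_eq_of_two_transitive (N := N) (x := x) h2 hcomm
    (‹N.Normal›.conj_mem h hh g) hk ?_⟩
  rw [← hg2, mul_smul, mul_smul, inv_smul_eq_iff.2 hg1.symm]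

end TwoTransitive

/-- If `g` moves `x`, 2-transitivity provides, for every `y ≠ x`, a conjugate of `g` that sends `x`
to `y`. -/
theorem IsHighlyTransitiveGroup.isICC {G : Type*} [Group G] (h : IsHighlyTransitiveGroup G) :
    IsICC G := by
  obtain ⟨X, _, _, _, hf, ht⟩ := h
  intro g hg
  obtain ⟨x, hx⟩ : ∃ x : X, g • x ≠ x := by
    by_contra! hcon
    exact hg (FaithfulSMul.eq_of_smul_eq_smul fun z : X => by rw [hcon, one_smul])
  have hsub : ({x}ᶜ : Set X) ⊆ (fun k : G => k • x) '' conjugatesOf g := by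
    intro y hy
    obtain ⟨k, hk1, hk2⟩ := ht.exists_smul_eq_pair hx.symm (Ne.symm hy)
    refine ⟨k * g * k⁻¹, isConj_iff.2 ⟨k, rfl⟩, ?_⟩
    simp only
    rw [mul_smul, mul_smul, inv_smul_eq_iff.2 hk1.symm, hk2]
  intro hfin
  exact (Set.finite_singleton x).infinite_compl ((hfin.image _).subset hsub)

/-- The last nontrivial derived subgroup is abelian and normal, hence acts regularly. An element
fixing `x`, `h • x` and `k • x` then commutes with `h` and `k`, so it also fixes `(h * k) • x`; this
contradicts 4-transitivity. -/
theorem IsHighlyTransitiveGroup.not_isSolvable {G : Type*} [Group G]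
    (h : IsHighlyTransitiveGroup G) : ¬ Group.IsSolvable G := by
  classical
  obtain ⟨X, _, _, _, hf, ht⟩ := h
  intro hs
  have h2 : ∀ {x y x' y' : X}, x ≠ y → x' ≠ y' → ∃ g : G, g • x = x' ∧ g • y = y' :=
    fun hxy hxy' => ht.exists_smul_eq_pair hxy hxy'
  have hex := hs.solvable
  obtain ⟨N, hN, hcomm, h₀, hh₀, hne⟩ : ∃ N : Subgroup G, N.Normal ∧
      (∀ g ∈ N, ∀ h ∈ N, g * h = h * g) ∧ ∃ h ∈ N, h ≠ 1 := by
    have hspec := Nat.find_spec hex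
    cases hn : Nat.find hex with
    | zero =>
      exfalso
      rw [hn, derivedSeries_zero] at hspec
      obtain ⟨x, y, hxy⟩ := exists_pair_ne X
      obtain ⟨g, hg, -⟩ := h2 hxy hxy.symm
      have : g ∈ (⊥ : Subgroup G) := hspec ▸ Subgroup.mem_top g
      rw [Subgroup.mem_bot.1 this, one_smul] at hg
      exact hxy hg
    | succ n =>
      rw [hn, derivedSeries_succ, Subgroup.commutator_eq_bot_iff_le_centralizer] at hspec
      refine ⟨derivedSeries G n, derivedSeries_normal G n, fun g hg h hh =>
        Subgroup.mem_centralizer_iff.1 (hspec hh) g hg, ?_⟩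
      by_contra! hcon
      exact Nat.find_min hex (hn ▸ Nat.lt_succ_self n) ((Subgroup.eq_bot_iff_forall _).2 hcon)
  have htrans := exists_mem_smul_eq_of_two_transitive (X := X) (N := N) h2 hh₀ hne
  have hfree : ∀ {g h : G}, g ∈ N → h ∈ N → ∀ {x : X}, g • x = h • x → g = h :=
    fun hg hh _ hx => eq_of_smul_eq_of_two_transitive (N := N) h2 hcomm hg hh hx
  have x : X := Classical.arbitrary X
  obtain ⟨p, hp⟩ := Infinite.exists_notMem_finset ({x} : Finset X)
  obtain ⟨h, hh, rfl⟩ := htrans x p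
  -- Avoiding `h⁻¹ • x` guarantees `(h * k) • x ≠ x`.
  obtain ⟨q, hq⟩ := Infinite.exists_notMem_finset ({x, h • x, h⁻¹ • x} : Finset X)
  obtain ⟨k, hk, rfl⟩ := htrans x q
  obtain ⟨y, hy⟩ := Infinite.exists_notMem_finset ({x, h • x, k • x, (h * k) • x} : Finset X)
  simp only [Finset.mem_insert, Finset.mem_singleton, not_or] at hp hq hy
  obtain ⟨hq1, hq2, hq3⟩ := hq
  obtain ⟨hy1, hy2, hy3, hy4⟩ := hy
  have e1 : (h * k) • x ≠ x := by
    rw [mul_smul]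
    exact fun he => hq3 (eq_inv_smul_iff.2 he)
  have e2 : (h * k) • x ≠ h • x := by
    rw [mul_smul]
    exact fun he => hq1 (smul_left_cancel _ he)
  have e3 : (h * k) • x ≠ k • x := by
    intro he
    have := hfree (N.mul_mem hh hk) hk he
    rw [mul_eq_right] at this
    rw [this, one_smul] at hp
    exact hp rfl
  have inj : ∀ z : X, z ≠ x → z ≠ h • x → z ≠ k • x →
      Function.Injective ![x, h • x, k • x, z] := by
    intro z h1 h2 h3 i j hij
    fin_cases i <;> fin_cases j <;> simp_all [eq_comm]
  obtain ⟨g, hg⟩ := ht 4 ⟨_, inj _ e1 e2 e3⟩ ⟨_, inj y hy1 hy2 hy3⟩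
  have g0 : g • x = x := hg 0
  have g1 : g • h • x = h • x := hg 1
  have g2 : g • k • x = k • x := hg 2
  have g3 : g • (h * k) • x = y := hg 3
  have c1 : g * h * g⁻¹ = h := hfree (hN.conj_mem h hh g) hh (x := x)
    (by rw [mul_smul, mul_smul, inv_smul_eq_iff.2 g0.symm, g1])
  have c2 : g * k * g⁻¹ = k := hfree (hN.conj_mem k hk g) hk (x := x)
    (by rw [mul_smul, mul_smul, inv_smul_eq_iff.2 g0.symm, g2])
  have c3 : g * (h * k) = h * k * g := by
    rw [mul_inv_eq_iff_eq_mul] at c1 c2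
    rw [← mul_assoc, c1, mul_assoc, c2, mul_assoc]
  rw [← mul_smul, c3, mul_smul, g0] at g3
  exact hy4 g3.symm

theorem one_le_transitivityDegree (G : Type*) [Group G] : 1 ≤ transitivityDegree G := by
  refine le_iSup_of_le G (le_iSup_of_le inferInstance (le_iSup_of_le inferInstance ?_))
  refine le_iSup_of_le 1 (le_iSup_of_le ?_ le_rfl)
  refine fun x y => ⟨y 0 * (x 0)⁻¹, fun i => ?_⟩
  rw [Subsingleton.elim i 0, smul_eq_mul, inv_mul_cancel_right]

/-- A faithful action of an infinite group is on an infinite set, where `k`-transitivity with `k ≥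
2` descends to 2-transitivity. -/
theorem transitivityDegree_le_one.{v} {G : Type v} [Group G] [Infinite G]
    (h : ∀ (X : Type v) [MulAction G X] [FaithfulSMul G X] [Infinite X],
      ¬ ∀ {x y x' y' : X}, x ≠ y → x' ≠ y' → ∃ g : G, g • x = x' ∧ g • y = y') :
    transitivityDegree G ≤ 1 := by
  refine iSup_le fun X => iSup_le fun _ => iSup_le fun hf => iSup_le fun k => iSup_le fun hk => ?_
  have hX : Infinite X := by
    by_contra hX
    rw [not_infinite_iff_finite] at hX
    have := Finite.of_injective (fun (g : G) (x : X) => g • x)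
      fun g g' hg => FaithfulSMul.eq_of_smul_eq_smul fun x : X => congrFun hg x
    exact not_finite G
  by_contra hk1
  have h2k : 2 ≤ k := by
    by_contra hlt
    exact hk1 (by exact_mod_cast (by lia : k ≤ 1))
  have : MulAction.IsMultiplyPretransitive G X k := ⟨fun x y => by
    obtain ⟨g, hg⟩ := hk x y
    exact ⟨g, Function.Embedding.ext hg⟩⟩
  have h2 := MulAction.isMultiplyPretransitive_of_le' (G := G) (α := X) h2k
    (by simp [ENat.card_eq_top_of_infinite])
  exact h X fun hxy hxy' => MulAction.is_two_pretransitive_iff.1 h2 hxy hxy'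

theorem IsHighlyTransitiveGroup.transitivityDegree_eq_top {G : Type*} [Group G]
    (h : IsHighlyTransitiveGroup G) : transitivityDegree G = ⊤ := by
  obtain ⟨X, _, _, hX, hf, ht⟩ := h
  rw [eq_top_iff]
  refine le_iSup_of_le X (le_iSup_of_le hX (le_iSup_of_le hf ?_))
  rw [← ENat.iSup_natCast]
  exact iSup_mono fun k => le_iSup_of_le (ht k) le_rfl

theorem AdmitsHighlyTransitiveHighlyFaithfulAction.isHighlyTransitiveGroup {G : Type*} [Group G]
    (h : AdmitsHighlyTransitiveHighlyFaithfulAction G) : IsHighlyTransitiveGroup G := by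
  obtain ⟨X, hi, hc, hX, ht, hf⟩ := h
  refine ⟨X, hi, hc, hX, ⟨fun {g g'} hg => ?_⟩, ht⟩
  by_contra hne
  obtain ⟨x, hx⟩ := (hf {g'⁻¹ * g} (by
    simpa [eq_comm, inv_mul_eq_one] using hne)).nonempty
  have := hx _ (Finset.mem_singleton_self _)
  rw [mul_smul, hg, inv_smul_smul] at this
  exact this rfl

/-! ### The excluded parameters -/

namespace BaumslagSolitar

variable {m n : ℤ}

instance infinite_of_ne_zero [NeZero m] [NeZero n] : Infinite (BaumslagSolitar m n) :=
  Infinite.of_injective (fun k : ℤ => (b : BaumslagSolitar m n) ^ k) fun k l h => by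
    have h1 : (b : BaumslagSolitar m n) ^ (k - l) = 1 := by
      rw [zpow_sub]
      exact mul_inv_eq_one.2 h
    exact sub_eq_zero.1 ((b_zpow_eq_one_iff (NeZero.ne m) (NeZero.ne n)).1 h1)

theorem normal_of_conj_mem_iff {N : Subgroup (BaumslagSolitar m n)}
    (ha : ∀ h, h ∈ N ↔ a * h * a⁻¹ ∈ N) (hb : ∀ h, h ∈ N ↔ b * h * b⁻¹ ∈ N) : N.Normal := by
  rw [← Subgroup.normalizer_eq_top_iff, eq_top_iff, ← closure_eq_top, Subgroup.closure_le]
  rintro _ (rfl | rfl)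
  · exact Subgroup.mem_normalizer_iff.2 ha
  · exact Subgroup.mem_normalizer_iff.2 hb

/-- The elements of a group which all large powers of `s` conjugate into the cyclic group generated
by `t`. -/
def ascending {H : Type*} [Group H] (s t : H) : Subgroup H where
  carrier := {g | ∃ k : ℕ, ∀ l ≥ k, ∃ j : ℤ, s ^ l * g * (s ^ l)⁻¹ = t ^ j}
  one_mem' := ⟨0, fun l _ => ⟨0, by simp⟩⟩
  mul_mem' := by
    rintro x y ⟨k, hk⟩ ⟨k', hk'⟩
    refine ⟨max k k', fun l hl => ?_⟩
    obtain ⟨i, hi⟩ := hk l (le_of_max_le_left hl)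
    obtain ⟨j, hj⟩ := hk' l (le_of_max_le_right hl)
    exact ⟨i + j, by rw [zpow_add, ← hi, ← hj]; group⟩
  inv_mem' := by
    rintro x ⟨k, hk⟩
    refine ⟨k, fun l hl => ?_⟩
    obtain ⟨i, hi⟩ := hk l hl
    exact ⟨-i, by rw [zpow_neg, ← hi]; group⟩

section Ascending

variable {H : Type*} [Group H] {s t : H}

/-- A common large power of `s` conjugates both elements into one cyclic group. -/
theorem ascending_comm : ∀ x ∈ ascending s t, ∀ y ∈ ascending s t, x * y = y * x := by
  rintro x ⟨k, hk⟩ y ⟨k', hk'⟩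
  obtain ⟨i, hi⟩ := hk _ (le_max_left k k')
  obtain ⟨j, hj⟩ := hk' _ (le_max_right k k')
  have h1 : s ^ max k k' * (x * y) * (s ^ max k k')⁻¹ =
      s ^ max k k' * (y * x) * (s ^ max k k')⁻¹ := by
    rw [← conj_mul, ← conj_mul, hi, hj, ← zpow_add, ← zpow_add, add_comm]
  exact mul_left_cancel (mul_right_cancel h1)

theorem zpow_mem_ascending {r : ℤ} (h : s * t * s⁻¹ = t ^ r) (i : ℤ) : t ^ i ∈ ascending s t := by
  refine ⟨0, fun l _ => ?_⟩
  induction l with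
  | zero => exact ⟨i, by simp⟩
  | succ l ih =>
    obtain ⟨j, hj⟩ := ih (Nat.zero_le _)
    refine ⟨r * j, ?_⟩
    rw [zpow_mul, ← h, conj_zpow, ← hj, pow_succ']
    group

/-- Conjugating by `s` only shifts the exponent by one, which a condition on all large exponents
tolerates in both directions. -/
theorem mem_ascending_iff_conj (g : H) : g ∈ ascending s t ↔ s * g * s⁻¹ ∈ ascending s t := by
  have key : ∀ l : ℕ, s ^ l * (s * g * s⁻¹) * (s ^ l)⁻¹ = s ^ (l + 1) * g * (s ^ (l + 1))⁻¹ := by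
    intro l
    rw [pow_succ]
    group
  constructor
  · rintro ⟨k, hk⟩
    exact ⟨k, fun l hl => by rw [key]; exact hk _ (by lia)⟩
  · rintro ⟨k, hk⟩
    refine ⟨k + 1, fun l hl => ?_⟩
    obtain ⟨l, rfl⟩ : ∃ l', l = l' + 1 := ⟨l - 1, by lia⟩
    rw [← key]
    exact hk l (by lia)

theorem mem_ascending_iff_conj_of_mem {u : H} (hu : u ∈ ascending s t) (g : H) :
    g ∈ ascending s t ↔ u * g * u⁻¹ ∈ ascending s t := by
  refine ⟨fun hg => mul_mem (mul_mem hu hg) (inv_mem hu), fun hg => ?_⟩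
  have := mul_mem (mul_mem (inv_mem hu) hg) hu
  simpa [mul_assoc] using this

end Ascending

/-- If `|m| = 1` or `|n| = 1`, the normal closure of `b` is abelian, with cyclic quotient. -/
theorem exists_abelian_normal_of_abs_eq_one (h : |m| = 1 ∨ |n| = 1) :
    ∃ N : Subgroup (BaumslagSolitar m n), N.Normal ∧ (∀ x ∈ N, ∀ y ∈ N, x * y = y * x) ∧
      ∀ i : ℤ, b ^ i ∈ N := by
  rcases h with h | h
  -- As `m = ±1`, the `m`-th power of the relation reads `a * b * a⁻¹ = b ^ (n * m)`. In the other
  -- case `a⁻¹` takes the role of `a`.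
  · have hm : m * m = 1 := by
      rw [← abs_mul_abs_self, h, one_mul]
    have hr : (a * b * a⁻¹ : BaumslagSolitar m n) = b ^ (n * m) := by
      rw [zpow_mul, ← relation, conj_zpow, ← zpow_mul, hm, zpow_one]
    exact ⟨ascending a b, normal_of_conj_mem_iff (mem_ascending_iff_conj)
      (mem_ascending_iff_conj_of_mem (by simpa using zpow_mem_ascending hr 1)),
      ascending_comm, zpow_mem_ascending hr⟩
  · have hn : n * n = 1 := by
      rw [← abs_mul_abs_self, h, one_mul]
    have hr : (a⁻¹ * b * a⁻¹⁻¹ : BaumslagSolitar m n) = b ^ (m * n) := by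
      have h1 : (b ^ (m * n) : BaumslagSolitar m n) = a⁻¹ * (b ^ n) ^ n * a := by
        rw [zpow_mul, ← relation, conj_zpow]
        group
      rw [h1, ← zpow_mul, hn, zpow_one, inv_inv]
    refine ⟨ascending a⁻¹ b, normal_of_conj_mem_iff (fun g => ?_)
      (mem_ascending_iff_conj_of_mem (by simpa using zpow_mem_ascending hr 1)),
      ascending_comm, zpow_mem_ascending hr⟩
    rw [mem_ascending_iff_conj (a * g * a⁻¹)]
    simp [mul_assoc]

theorem isSolvable_of_abs_eq_one (h : |m| = 1 ∨ |n| = 1) :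
    Group.IsSolvable (BaumslagSolitar m n) := by
  obtain ⟨N, hN, hcomm, hb⟩ := exists_abelian_normal_of_abs_eq_one h
  have hb1 : (b : BaumslagSolitar m n) ∈ N := by simpa using hb 1
  have hq : ∀ g : BaumslagSolitar m n, ∃ i : ℤ,
      QuotientGroup.mk' N g = (QuotientGroup.mk' N a) ^ i := by
    intro g
    induction g using induction with
    | ha => exact ⟨1, by simp⟩
    | hb => exact ⟨0, by rw [zpow_zero]; exact (QuotientGroup.eq_one_iff _).2 hb1⟩
    | hmul x y hx hy =>
      obtain ⟨i, hi⟩ := hx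
      obtain ⟨j, hj⟩ := hy
      exact ⟨i + j, by rw [map_mul, hi, hj, zpow_add]⟩
    | hinv x hx =>
      obtain ⟨i, hi⟩ := hx
      exact ⟨-i, by rw [map_inv, hi, zpow_neg]⟩
  have h1 : Group.IsSolvable N := Group.isSolvable_of_comm fun x y =>
    Subtype.ext (hcomm x x.2 y y.2)
  have h2 : Group.IsSolvable (BaumslagSolitar m n ⧸ N) := Group.isSolvable_of_comm fun x y => by
    obtain ⟨x, rfl⟩ := QuotientGroup.mk'_surjective N x
    obtain ⟨y, rfl⟩ := QuotientGroup.mk'_surjective N y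
    obtain ⟨i, hi⟩ := hq x
    obtain ⟨j, hj⟩ := hq y
    rw [hi, hj, ← zpow_add, ← zpow_add, add_comm]
  exact Group.isSolvable_of_ker_le_range N.subtype (QuotientGroup.mk' N) (by simp)

theorem zpowers_normal_of_abs_eq (h : |m| = |n|) :
    (Subgroup.zpowers (b ^ m : BaumslagSolitar m n)).Normal := by
  obtain ⟨ε, hε, hmn⟩ : ∃ ε : ℤ, ε * ε = 1 ∧ n = m * ε := by
    rcases abs_eq_abs.1 h with rfl | rfl
    · exact ⟨1, by simp⟩
    · exact ⟨-1, by simp⟩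
  have hr : ∀ i : ℤ, a * (b ^ m) ^ i * a⁻¹ = (b ^ m : BaumslagSolitar m n) ^ (ε * i) := fun i => by
    rw [← conj_zpow, relation, zpow_mul, ← zpow_mul b m, ← hmn]
  refine normal_of_conj_mem_iff (fun g => ?_) fun g => ?_
  · simp only [Subgroup.mem_zpowers_iff]
    constructor
    · rintro ⟨i, rfl⟩
      exact ⟨_, (hr i).symm⟩
    · rintro ⟨i, hi⟩
      refine ⟨ε * i, mul_left_cancel (a := a) (mul_right_cancel (b := a⁻¹) ?_)⟩
      rw [hr, ← mul_assoc, hε, one_mul, hi]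
  · have hc : ∀ i : ℤ, b * (b ^ m) ^ i * b⁻¹ = (b ^ m : BaumslagSolitar m n) ^ i := fun i => by
      rw [mul_inv_eq_iff_eq_mul, ← zpow_mul, ← zpow_one_add, ← zpow_add_one, add_comm]
    simp only [Subgroup.mem_zpowers_iff]
    constructor
    · rintro ⟨i, rfl⟩
      exact ⟨i, (hc i).symm⟩
    · rintro ⟨i, hi⟩
      exact ⟨i, mul_left_cancel (a := b) (mul_right_cancel (b := b⁻¹) ((hc i).trans hi))⟩

/-- All conjugates of `b ^ m` are powers of it by normality, and the affine action has ratio `±1`,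
leaving only `b ^ m` and `b ^ (-m)`. -/
theorem not_isICC_of_abs_eq (hm : m ≠ 0) (hn : n ≠ 0) (h : |m| = |n|) :
    ¬ IsICC (BaumslagSolitar m n) := by
  intro hicc
  have hN := zpowers_normal_of_abs_eq h
  refine hicc (b ^ m) (fun h1 => hm ((b_zpow_eq_one_iff hm hn).1 h1)) ?_
  refine Set.Finite.subset (Set.toFinite {b ^ m, b ^ (-m)}) fun g hg => ?_
  obtain ⟨c, rfl⟩ := isConj_iff.1 hg
  obtain ⟨j, hj⟩ := Subgroup.mem_zpowers_iff.1
    (hN.conj_mem _ (Subgroup.mem_zpowers (b ^ m : BaumslagSolitar m n)) c)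
  rw [← zpow_mul] at hj
  obtain ⟨i, hi⟩ := exists_zpow_eq_of_conj hm hn hj.symm
  have hr : |(n / m : ℚ)| = 1 := by
    rw [abs_div, ← Int.cast_abs, ← Int.cast_abs, h, div_self]
    exact_mod_cast abs_ne_zero.2 hn
  have h1 := congrArg abs hi
  rw [abs_mul, abs_zpow, hr, one_zpow, one_mul, ← Int.cast_abs, ← Int.cast_abs] at h1
  rw [← hj]
  rcases abs_eq_abs.1 (Int.cast_injective h1) with h2 | h2
  · rw [← h2]
    exact .inl rfl
  · rw [show m * j = -m by lia]
    exact .inr rfl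

/-- If `|m| = 1` or `|n| = 1` or `|m| = |n|`, some integer greater than `1` is not a power of
`n / m`. -/
theorem exists_ne_zpow_div (hm : m ≠ 0) (hn : n ≠ 0) (h : |m| = 1 ∨ |n| = 1 ∨ |m| = |n|) :
    ∃ q : ℤ, 1 < q ∧ ∀ i : ℤ, (n / m : ℚ) ^ i ≠ q := by
  obtain ⟨s, hs0, hs⟩ : ∃ s : ℤ, 1 ≤ s ∧ ∃ e : ℤ, |(n / m : ℚ)| = (s : ℚ) ^ e := by
    rcases h with h | h | h
    · exact ⟨|n|, Int.one_le_abs hn, 1, by rw [abs_div, ← Int.cast_abs (a := m), h]; simp⟩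
    · exact ⟨|m|, Int.one_le_abs hm, -1, by rw [abs_div, ← Int.cast_abs (a := n), h]; simp⟩
    · exact ⟨1, le_rfl, 0, by
        rw [abs_div, ← Int.cast_abs, ← Int.cast_abs, h, div_self (by
          exact_mod_cast abs_ne_zero.2 hn)]
        simp⟩
  obtain ⟨e, he⟩ := hs
  -- Up to sign the powers of `n / m` are powers of `s`. A nonpositive power is at most 1, and a
  -- positive one equal to `s + 1` would make `s` divide 1, so `s = 1` and `1 = 2`.
  refine ⟨s + 1, by lia, fun i hi => ?_⟩
  have h1 := congrArg abs hi
  rw [abs_zpow, he, ← zpow_mul, abs_of_pos (by positivity)] at h1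
  rcases le_or_gt (e * i) 0 with h2 | h2
  · have h3 : (s : ℚ) ^ (e * i) ≤ 1 := zpow_le_one_of_nonpos₀ (by exact_mod_cast hs0) h2
    rw [h1] at h3
    push_cast at h3
    have : (1 : ℚ) ≤ s := by exact_mod_cast hs0
    linarith
  · obtain ⟨k, hk⟩ : ∃ k : ℕ, e * i = k + 1 := ⟨(e * i - 1).toNat, by lia⟩
    rw [hk] at h1
    have h3 : s ^ (k + 1) = s + 1 := by
      exact_mod_cast h1
    have h4 : s ∣ 1 := by
      rw [← Int.dvd_add_right (dvd_refl s), ← h3]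
      exact dvd_pow_self s (Nat.succ_ne_zero k)
    have h5 : s = 1 := le_antisymm (Int.le_of_dvd one_pos h4) hs0
    rw [h5] at h3
    simp at h3

/-- In a faithful 2-transitive action `b ^ k` and `b ^ (k * q)`, both nontrivial in an abelian
normal subgroup, would be conjugate, making `q` a power of `n / m`. -/
theorem transitivityDegree_eq_one (hm : m ≠ 0) (hn : n ≠ 0)
    (h : |m| = 1 ∨ |n| = 1 ∨ |m| = |n|) : transitivityDegree (BaumslagSolitar m n) = 1 := by
  have := NeZero.mk hm
  have := NeZero.mk hn
  refine le_antisymm (transitivityDegree_le_one fun X _ _ _ h2 => ?_) (one_le_transitivityDegree _)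
  obtain ⟨q, hq1, hq⟩ := exists_ne_zpow_div hm hn h
  obtain ⟨N, hN, hcomm, k, hk0, hk⟩ : ∃ N : Subgroup (BaumslagSolitar m n), N.Normal ∧
      (∀ x ∈ N, ∀ y ∈ N, x * y = y * x) ∧ ∃ k : ℤ, k ≠ 0 ∧ b ^ k ∈ N := by
    have habs : |m| = 1 ∨ |n| = 1 → _ := exists_abelian_normal_of_abs_eq_one (m := m) (n := n)
    rcases h with h | h | h
    · obtain ⟨N, h1, h2, h3⟩ := habs (.inl h)
      exact ⟨N, h1, h2, 1, one_ne_zero, h3 1⟩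
    · obtain ⟨N, h1, h2, h3⟩ := habs (.inr h)
      exact ⟨N, h1, h2, 1, one_ne_zero, h3 1⟩
    · refine ⟨_, zpowers_normal_of_abs_eq h, fun x hx y hy => ?_, m, hm, Subgroup.mem_zpowers _⟩
      obtain ⟨i, rfl⟩ := Subgroup.mem_zpowers_iff.1 hx
      obtain ⟨j, rfl⟩ := Subgroup.mem_zpowers_iff.1 hy
      rw [← zpow_add, ← zpow_add, add_comm]
  have hkq : (b ^ (k * q) : BaumslagSolitar m n) ∈ N := by
    rw [zpow_mul]
    exact zpow_mem hk q
  have hne : ∀ l : ℤ, l ≠ 0 → (b ^ l : BaumslagSolitar m n) ≠ 1 := fun l hl h1 =>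
    hl ((b_zpow_eq_one_iff hm hn).1 h1)
  obtain ⟨g, hg⟩ := exists_conj_eq_of_two_transitive (X := X) (N := N) h2 hcomm hk hkq
    (hne k hk0) (hne _ (mul_ne_zero hk0 (by lia)))
  obtain ⟨i, hi⟩ := exists_zpow_eq_of_conj hm hn hg
  refine hq i (mul_right_cancel₀ (b := (k : ℚ)) (by exact_mod_cast hk0) ?_)
  rw [hi]
  push_cast
  ring

end BaumslagSolitar

theorem corollaryD :
    (∀ m n : ℤ, m ≠ 0 → n ≠ 0 →
      List.TFAE
        [|m| ≠ 1 ∧ |n| ≠ 1 ∧ |m| ≠ |n|,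
          AdmitsHighlyTransitiveHighlyFaithfulAction (BaumslagSolitar m n),
          IsHighlyTransitiveGroup (BaumslagSolitar m n),
          ¬ Group.IsSolvable (BaumslagSolitar m n) ∧ IsICC (BaumslagSolitar m n)] ∧
      (|m| = 1 ∨ |n| = 1 ∨ |m| = |n| → transitivityDegree (BaumslagSolitar m n) = 1) ∧
      (|m| ≠ 1 → |n| ≠ 1 → |m| ≠ |n| → transitivityDegree (BaumslagSolitar m n) = ⊤)) ∧
    IsHighlyTransitiveGroup (BaumslagSolitar 2 3) := by
  have main : ∀ m n : ℤ, m ≠ 0 → n ≠ 0 → |m| ≠ 1 → |n| ≠ 1 → |m| ≠ |n| →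
      AdmitsHighlyTransitiveHighlyFaithfulAction (BaumslagSolitar m n) :=
    fun m n => BaumslagSolitar.admitsHighlyTransitiveHighlyFaithfulAction
  refine ⟨fun m n hm hn => ⟨?_, BaumslagSolitar.transitivityDegree_eq_one hm hn, fun h1 h2 h3 =>
    (main m n hm hn h1 h2 h3).isHighlyTransitiveGroup.transitivityDegree_eq_top⟩,
    (main 2 3 (by simp) (by simp) (by simp) (by simp) (by simp)).isHighlyTransitiveGroup⟩
  tfae_have 1 → 2 := fun ⟨h1, h2, h3⟩ => main m n hm hn h1 h2 h3
  tfae_have 2 → 3 := fun h => h.isHighlyTransitiveGroup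
  tfae_have 3 → 4 := fun h => ⟨h.not_isSolvable, h.isICC⟩
  tfae_have 4 → 1 := fun ⟨h1, h2⟩ =>
    ⟨fun h => h1 (BaumslagSolitar.isSolvable_of_abs_eq_one (.inl h)),
      fun h => h1 (BaumslagSolitar.isSolvable_of_abs_eq_one (.inr h)),
      fun h => BaumslagSolitar.not_isICC_of_abs_eq hm hn h h2⟩
  tfae_finish
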